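/- Let $\tau\in\mathbb C$ with $\operatorname{Im}\tau>0$, let $\wp$ be the Weierstrass function of the lattice $\Lambda=\mathbb Z+\tau\mathbb Z$, let $\theta_1(v)=e^{\frac{i\pi}{4}\tau+i\pi(v+\frac12)}\sum_{n\in\mathbb Z}e^{i\pi n^2\tau+2i\pi n(v+\frac12+\frac\tau2)}$, and write $z=\wp(v)$. Let $\alpha,\beta\in\mathbb R$ and $\mathcal X=\beta-\tau\alpha$ with $\theta_1(\mathcal X)\neq0$, and let $$S(v,w)=e^{2i\pi\alpha(v-w)}\frac{\theta_1'(0)\,\theta_1(v-w-\mathcal X)}{\theta_1(\mathcal X)\,\theta_1(w-v)},\qquad \varphi_\ell(v)=\partial_w^\ell S(v,w)\big|_{w=0},\qquad \Phi=\begin{pmatrix}\varphi_0(v)&\varphi_0(-v)\\ \varphi_1(v)&\varphi_1(-v)\end{pmatrix}$$ (the coefficients of the Szegő kernel and of the half-differentials $\varphi_\ell\sqrt{dv}$). Let $R\ge1$ and $a,b\in\mathbb Z$ be such that $q=\frac{b+a\tau}{2R}$ is neither a period nor a half-period, i.e. $2q\notin\Lambda$. Put $z_\star=\wp(q)$ and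 $$Y(v)=\pm\Big(e^{2i\pi\frac aR v}\,\frac{\theta_1(v+q)}{\theta_1(v-q)}\Big)^R .$$ Then: 1. There is a matrix function $\sqrt W$ of $z$ with $\sqrt W(\wp(v))=\Phi\,\mathrm{diag}(Y(v),Y(-v))\,\Phi^{-1}$ for all $v$ with $2v\notin\Lambda$ and $\wp(v)\ne z_\star$. Put $W=(\sqrt W)^2$. 2. For some $r>0$ there are a holomorphic branch $w\mapsto w^{(1)}$ of $\wp^{-1}$ on $|w-z_\star|<r$ with $z_\star^{(1)}=q$, and a $2\times2$ matrix $P_{R-1}$ of polynomials of degree at most $R-1$, independent of $\varepsilon$, such that the following holds for all $0<\varepsilon<r$. (a) For every $z$ with $|z-z_\star|>\varepsilon$ that is not a branch point of $\wp$, $$P_{R-1}(z)=(z-z_\star)^R\oint_{|w-z_\star|=\varepsilon}\Phi(w)\,\mathbb E_{11}\,\Phi(w)^{-1}\frac{dw}{(w-z_\star)^{2R}(w-z)\,2i\pi}\;\sqrt W(z)^{-1},$$ where $\Phi(w)$ is evaluated at $v=w^{(1)}$ and $\mathbb E_{11}=\mathrm{diag}(1,0)$. (b) For all integers $\ell$ with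 $0\le\ell\le R-2$, $$\oint_{|z-z_\star|=\varepsilon}P_{R-1}(z)\,W(z)\,z^\ell\,dz=0 .$$ -/

import Mathlib

open scoped UpperHalfPlane Real

noncomputable section

namespace EllipticMOP

/-- The periods `1, τ` of the elliptic curve `ℂ / (ℤ + τ ℤ)`. -/
def periods (τ : ℍ) : PeriodPair where
  ω₁ := 1
  ω₂ := (τ : ℂ)
  indep := by
    rw [LinearIndependent.pair_iff]
    intro s t h
    have him := congrArg Complex.im h
    have hre := congrArg Complex.re h
    have hτ : (τ : ℂ).im ≠ 0 := τ.im_pos.ne'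
    simp at him hre
    have ht : t = 0 := by
      rcases him with h | h
      · exact h
      · exact absurd h τ.im_pos.ne'
    subst ht
    simpa using hre

/-- The projection `z = ℘(v)` from the curve to the `z`-plane. -/
def wp (τ : ℍ) (v : ℂ) : ℂ := (periods τ).weierstrassP v

/-- `v` is a period or a half-period, i.e. `v ∈ ½ (ℤ + τ ℤ)`. These are the points over `∞` and over
the branch points of `z = ℘(v)`. -/
def IsHalfPeriod (τ : ℍ) (v : ℂ) : Prop := ∃ m n : ℤ, 2 * v = m + n * (τ : ℂ)

/-- The odd Jacobi theta function
`θ₁(v) = e^{iπτ/4 + iπ(v+1/2)} ∑ₙ e^{iπn²τ + 2iπn(v + 1/2 + τ/2)}`. -/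
def theta1 (τ : ℍ) (v : ℂ) : ℂ :=
  Complex.exp (Complex.I * π * τ / 4 + Complex.I * π * (v + 1 / 2)) *
    jacobiTheta₂ (v + 1 / 2 + τ / 2) τ

/-- The point `𝒳 = β - τ α` of the Jacobian that corresponds to the multiplier system with
`𝒳(a) = e^{2iπα}`, `𝒳(b) = e^{2iπβ}`. -/
def chi (τ : ℍ) (α β : ℝ) : ℂ := (β : ℂ) - τ * α

/-- The coefficient of `√dv √dw` in the Szegő kernel. -/
def szego (τ : ℍ) (α β : ℝ) (v w : ℂ) : ℂ :=
  Complex.exp (2 * Complex.I * π * α * (v - w)) *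
    (deriv (theta1 τ) 0 * theta1 τ (v - w - chi τ α β) /
      (theta1 τ (chi τ α β) * theta1 τ (w - v)))

/-- The coefficient of `√dv` in the section `φ_ℓ`, the `ℓ`-th `w`-derivative of the Szegő kernel
at `w = 0`. -/
def phi (τ : ℍ) (α β : ℝ) (ℓ : ℕ) (v : ℂ) : ℂ :=
  iteratedDeriv ℓ (fun w => szego τ α β v w) 0

/-- The matrix `Φ`, at the point `z = ℘(v)` whose preimages on the first and second sheet are
`v` and `-v`. The half-differential `√dv` multiplies each column by a nonzero
scalar, which cancels in every expression `Φ D Φ⁻¹` with `D` diagonal. -/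
def Phi (τ : ℍ) (α β : ℝ) (v : ℂ) : Matrix (Fin 2) (Fin 2) ℂ :=
  !![phi τ α β 0 v, phi τ α β 0 (-v);
     phi τ α β 1 v, phi τ α β 1 (-v)]

/-- The `2R`-torsion point `q = (b + a τ) / (2R)`. -/
def torsionPt (τ : ℍ) (R : ℕ) (a b : ℤ) : ℂ := (b + a * (τ : ℂ)) / (2 * R)

/-- The elliptic function `Y(v) = s (e^{2iπ(a/R)v} θ₁(v + q) / θ₁(v - q))^R`, with a sign `s = ±1`,
which has a pole of order `R` at `q` and a zero of order `R` at `-q`. -/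
def Y (τ : ℍ) (R : ℕ) (a b : ℤ) (s : ℤˣ) (v : ℂ) : ℂ :=
  ((s : ℤ) : ℂ) *
    (Complex.exp (2 * Complex.I * π * (a / R) * v) *
      (theta1 τ (v + torsionPt τ R a b) / theta1 τ (v - torsionPt τ R a b))) ^ R

/-- `z⋆ = ℘(q)`. -/
def zStar (τ : ℍ) (R : ℕ) (a b : ℤ) : ℂ := wp τ (torsionPt τ R a b)

/-- `sqrtW`, a function of `z`, is the matrix `√W` defined by
`√W(z) = Φ(z) diag(Y(z⁽¹⁾), Y(z⁽²⁾)) Φ(z)⁻¹`: the formula holds for both labellings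
`(z⁽¹⁾, z⁽²⁾) = (v, -v)` of the preimages of `z` and for all their representatives modulo the
periods, at every finite `z` other than `z⋆` and the branch points. -/
def IsSqrtWeight (τ : ℍ) (α β : ℝ) (R : ℕ) (a b : ℤ) (s : ℤˣ)
    (sqrtW : ℂ → Matrix (Fin 2) (Fin 2) ℂ) : Prop :=
  ∀ v : ℂ, ¬ IsHalfPeriod τ v → wp τ v ≠ zStar τ R a b →
    sqrtW (wp τ v) =
      Phi τ α β v * Matrix.diagonal ![Y τ R a b s v, Y τ R a b s (-v)] * (Phi τ α β v)⁻¹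

/-- `ν` is the main sheet `z ↦ z⁽¹⁾` over the disc of radius `r` about `z⋆`: the holomorphic
inverse branch of `℘` that sends `z⋆` to the pole `q` of `Y`. -/
def IsMainSheet (τ : ℍ) (R : ℕ) (a b : ℤ) (r : ℝ) (ν : ℂ → ℂ) : Prop :=
  DifferentiableOn ℂ ν (Metric.ball (zStar τ R a b) r) ∧
  ν (zStar τ R a b) = torsionPt τ R a b ∧
  ∀ z ∈ Metric.ball (zStar τ R a b) r, wp τ (ν z) = z

/-- Entrywise contour integral of a matrix-valued function over the circle `|z - c| = ε`,
counterclockwise. -/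
def matCircleIntegral (F : ℂ → Matrix (Fin 2) (Fin 2) ℂ) (c : ℂ) (ε : ℝ) :
    Matrix (Fin 2) (Fin 2) ℂ :=
  Matrix.of fun i j => ∮ z in C(c, ε), F z i j

/-- The projector `Φ(w) E₁₁ Φ(w)⁻¹` onto the eigenline of the first sheet, where `v = w⁽¹⁾`. -/
def sheetProj (τ : ℍ) (α β : ℝ) (v : ℂ) : Matrix (Fin 2) (Fin 2) ℂ :=
  Phi τ α β v * Matrix.single 0 0 1 * (Phi τ α β v)⁻¹

/-- The expression
`(z - z⋆)^R ∮_{|w - z⋆| = ε} Φ(w) E₁₁ Φ(w)⁻¹ dw / ((w - z⋆)^{2R} (w - z) 2iπ) · √W(z)⁻¹`. -/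
def mopFormula (τ : ℍ) (α β : ℝ) (R : ℕ) (a b : ℤ) (ν : ℂ → ℂ)
    (sqrtW : ℂ → Matrix (Fin 2) (Fin 2) ℂ) (ε : ℝ) (z : ℂ) : Matrix (Fin 2) (Fin 2) ℂ :=
  (z - zStar τ R a b) ^ R •
    (matCircleIntegral
      (fun w => ((w - zStar τ R a b) ^ (2 * R) * (w - z) * (2 * Complex.I * π))⁻¹ •
        sheetProj τ α β (ν w))
      (zStar τ R a b) ε * (sqrtW z)⁻¹)

/-- The value at `z` of a matrix of polynomials. -/
def evalMat (P : Matrix (Fin 2) (Fin 2) (Polynomial ℂ)) (z : ℂ) : Matrix (Fin 2) (Fin 2) ℂ :=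
  P.map (Polynomial.eval z)

end EllipticMOP

end

open EllipticMOP

namespace EllipticMOP

/-! Write `c` for `z⋆`. The proof reduces to linear algebra over polynomials, applied to `N(z) = (z
- c)^R √W(z)`.

The matrix `N` is polynomial of degree at most `R` (`exists_polynomial_weight`). Indeed `(℘ - c)^R
Y` extends to an elliptic function `clearedY` with poles on the lattice only, and `φ_i(v) φ_j(-v)`
is elliptic because the multipliers of the two factors cancel. Hence `Φ diag Φ^adj` has elliptic
entries. They are odd, so each is `℘'` times a polynomial in `℘`, and `det Φ = -℘'` (`det_Phi`)
cancels the factor `℘'`. Since `Y(v) Y(-v) = 1`, `det N = (z - c)^(2R)`.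

Near `c`, on the sheet through `q`, `N = y M + ((z - c)^(2R) / y) (1 - M)`, where `M` is the
holomorphic spectral projector and `y` does not vanish; here `2q ∉ Λ` enters. The adjugate exchanges
the two eigenvalues, so `M N^adj` vanishes at `c` to order `2R`. If `T` is the Taylor polynomial of
`M` at `c` of degree at most `2R - 1`, then `T N^adj = (z - c)^(2R) Q` with `Q` a polynomial matrix
of degree at most `(2R - 1) + R - 2R = R - 1` (`exists_quotient`). The answer is `P = -Q`, visibly
independent of `ε`.

Formula (a): outside the circle, the Cauchy transform of `M / (w - c)^(2R)` is `-T(z) / (z -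
c)^(2R)`, and `√W⁻¹ = (z - c)^(-R) N^adj`. Orthogonality (b): `Q N = T`, so `Q W = T N / (z -
c)^(2R)`, which differs from `N / (z - c)^(2R)` by a function holomorphic at `c`. The product of
`z^ℓ` with the latter is `O(z⁻²)` at infinity for `ℓ ≤ R - 2`, hence has no residue at its only
pole. -/

open Filter Topology Asymptotics

/-! ### Elliptic functions with poles on the lattice, and Liouville's theorem -/

/-- `f` is an elliptic function for the lattice of `L`, holomorphic off the lattice, with poles of
order at most `n` at the lattice points. Its values at the lattice points are arbitrary. -/
structure IsEllipticLE (L : PeriodPair) (n : ℕ) (f : ℂ → ℂ) : Prop where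
  periodic : ∀ v, ∀ l ∈ L.lattice, f (v + l) = f v
  differentiableAt : ∀ v ∉ L.lattice, DifferentiableAt ℂ f v
  isBigO : (fun v => v ^ n * f v) =O[𝓝[≠] 0] (fun _ => (1 : ℝ))

variable {L : PeriodPair} {n m : ℕ} {f g : ℂ → ℂ}

lemma eventually_notMem_lattice (L : PeriodPair) : ∀ᶠ v in 𝓝[≠] (0 : ℂ), v ∉ L.lattice := by
  rw [eventually_nhdsWithin_iff]
  filter_upwards [L.compl_lattice_sdiff_singleton_mem_nhds 0] with v hv h0 hl
  exact hv ⟨hl, h0⟩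

lemma tendsto_id_nhdsNE_zero : Tendsto (fun v : ℂ => v) (𝓝[≠] 0) (𝓝 0) := nhdsWithin_le_nhds

lemma tendsto_neg_nhdsNE_zero : Tendsto (fun v : ℂ => -v) (𝓝[≠] 0) (𝓝[≠] 0) := by
  refine tendsto_nhdsWithin_iff.2 ⟨by simpa using tendsto_id_nhdsNE_zero.neg, ?_⟩
  filter_upwards [self_mem_nhdsWithin] with v hv
  simpa using hv

namespace IsEllipticLE

lemma mono (hf : IsEllipticLE L n f) (h : n ≤ m) : IsEllipticLE L m f where
  periodic := hf.periodic
  differentiableAt := hf.differentiableAt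
  isBigO := by
    obtain ⟨k, rfl⟩ := Nat.exists_eq_add_of_le' h
    have h1 : (fun v : ℂ => v ^ k) =O[𝓝[≠] 0] (fun _ => (1 : ℝ)) :=
      (tendsto_id_nhdsNE_zero.pow k).isBigO_one ℝ
    simpa [pow_add, mul_assoc] using h1.mul hf.isBigO

lemma add (hf : IsEllipticLE L n f) (hg : IsEllipticLE L n g) :
    IsEllipticLE L n (fun v => f v + g v) where
  periodic v l hl := by rw [hf.periodic v l hl, hg.periodic v l hl]
  differentiableAt v hv := (hf.differentiableAt v hv).add (hg.differentiableAt v hv)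
  isBigO := by simpa [mul_add] using hf.isBigO.add hg.isBigO

lemma const_mul (hf : IsEllipticLE L n f) (c : ℂ) : IsEllipticLE L n (fun v => c * f v) where
  periodic v l hl := by rw [hf.periodic v l hl]
  differentiableAt v hv := (hf.differentiableAt v hv).const_mul c
  isBigO := by simpa [mul_left_comm] using hf.isBigO.const_mul_left c

lemma sub (hf : IsEllipticLE L n f) (hg : IsEllipticLE L n g) :
    IsEllipticLE L n (fun v => f v - g v) := by
  simpa [sub_eq_add_neg] using hf.add (hg.const_mul (-1))

lemma mul (hf : IsEllipticLE L n f) (hg : IsEllipticLE L m g) :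
    IsEllipticLE L (n + m) (fun v => f v * g v) where
  periodic v l hl := by rw [hf.periodic v l hl, hg.periodic v l hl]
  differentiableAt v hv := (hf.differentiableAt v hv).mul (hg.differentiableAt v hv)
  isBigO := by
    have := hf.isBigO.mul hg.isBigO
    simp only [mul_one] at this
    refine this.congr_left fun v => by ring

lemma const (c : ℂ) : IsEllipticLE L 0 (fun _ => c) where
  periodic _ _ _ := rfl
  differentiableAt _ _ := differentiableAt_const c
  isBigO := by simpa using isBigO_const_const c (one_ne_zero (α := ℝ)) _

lemma pow (hf : IsEllipticLE L n f) (k : ℕ) : IsEllipticLE L (k * n) (fun v => f v ^ k) := by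
  induction k with
  | zero => simpa using const (L := L) 1
  | succ k ih => simpa [pow_succ, Nat.succ_mul] using ih.mul hf

lemma comp_neg (hf : IsEllipticLE L n f) : IsEllipticLE L n (fun v => f (-v)) where
  periodic v l hl := by rw [neg_add, hf.periodic (-v) (-l) (neg_mem hl)]
  differentiableAt v hv :=
    (hf.differentiableAt (-v) (fun h => hv (by simpa using neg_mem h))).comp v
      differentiableAt_id.neg
  isBigO := by
    have h := (hf.isBigO.comp_tendsto tendsto_neg_nhdsNE_zero).const_mul_left ((-1) ^ n)
    refine h.congr (fun v => ?_) (fun _ => rfl)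
    simp only [Function.comp_apply]
    rw [neg_pow v n, ← mul_assoc, ← mul_assoc, ← mul_pow]
    simp

/-- The function `v ^ n * f v` extends holomorphically through `0`. -/
lemma exists_tendsto (hf : IsEllipticLE L n f) :
    ∃ c, Tendsto (fun v => v ^ n * f v) (𝓝[≠] 0) (𝓝 c) := by
  refine ⟨_, Complex.tendsto_limUnder_of_differentiable_on_punctured_nhds_of_bounded_under ?_ ?_⟩
  · filter_upwards [eventually_notMem_lattice L] with v hv
    exact (differentiableAt_id.pow n).mul (hf.differentiableAt v hv)
  · exact (hf.isBigO.sub (isBigO_const_const (0 ^ n * f 0) one_ne_zero _)).isBoundedUnder_le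

/-- By the removable singularity theorem `v^(n+1) f` is holomorphic at `0`; it vanishes there, so it
is `O(v)` and one factor `v` can be divided out. -/
lemma of_tendsto_zero (hf : IsEllipticLE L (n + 1) f)
    (h : Tendsto (fun v => v ^ (n + 1) * f v) (𝓝[≠] 0) (𝓝 0)) : IsEllipticLE L n f where
  periodic := hf.periodic
  differentiableAt := hf.differentiableAt
  isBigO := by
    set g : ℂ → ℂ := fun v => v ^ (n + 1) * f v with hg
    have hg0 : g 0 = 0 := by simp [hg]
    have hcont : ContinuousAt g 0 := by
      rw [continuousAt_iff_punctured_nhds, hg0]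
      exact h
    have hd : DifferentiableAt ℂ g 0 := by
      refine (Complex.analyticAt_of_differentiable_on_punctured_nhds_of_continuousAt ?_
        hcont).differentiableAt
      filter_upwards [eventually_notMem_lattice L] with v hv
      exact (differentiableAt_id.pow _).mul (hf.differentiableAt v hv)
    have hO : g =O[𝓝[≠] 0] fun v => v := by
      simpa [hg0] using hd.hasDerivAt.isBigO_sub.mono (nhdsWithin_le_nhds (s := {0}ᶜ))
    have h2 := hO.mul (isBigO_refl (fun v : ℂ => v⁻¹) (𝓝[≠] 0))
    refine (h2.congr' ?_ ?_).trans (isBigO_const_const (1 : ℂ) (one_ne_zero (α := ℝ)) _)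
    · filter_upwards [self_mem_nhdsWithin] with v hv
      have hv : v ≠ 0 := hv
      simp only [hg, pow_succ]
      field_simp
    · filter_upwards [self_mem_nhdsWithin] with v hv
      exact mul_inv_cancel₀ hv

lemma of_tendsto (hf : IsEllipticLE L (n + 1) f) (hg : IsEllipticLE L (n + 1) g) {a b : ℂ}
    (ha : Tendsto (fun v => v ^ (n + 1) * f v) (𝓝[≠] 0) (𝓝 a))
    (hb : Tendsto (fun v => v ^ (n + 1) * g v) (𝓝[≠] 0) (𝓝 b)) (hb0 : b ≠ 0) :
    IsEllipticLE L n (fun v => f v - a / b * g v) := by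
  refine of_tendsto_zero (hf.sub (hg.const_mul _)) ?_
  have := ha.sub (hb.const_mul (a / b))
  rw [div_mul_cancel₀ _ hb0, sub_self] at this
  refine this.congr fun v => by ring

/-- A parity argument lowers the order of the pole. -/
lemma of_parity (hf : IsEllipticLE L (n + 1) f) {s : ℂ} (hs : ∀ v ∉ L.lattice, f (-v) = s * f v)
    (hsn : (-1) ^ (n + 1) * s = -1) : IsEllipticLE L n f := by
  obtain ⟨c, hc⟩ := hf.exists_tendsto
  -- The sign condition `hsn` says that `v^(n+1) f` is odd, so its limit `c` equals `-c`.
  have h1 : Tendsto (fun v => -(v ^ (n + 1) * f v)) (𝓝[≠] 0) (𝓝 c) := by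
    refine (hc.comp tendsto_neg_nhdsNE_zero).congr' ?_
    filter_upwards [eventually_notMem_lattice L] with v hv
    simp only [Function.comp_apply, hs v hv]
    rw [neg_pow v]
    linear_combination (v ^ (n + 1) * f v) * hsn
  have hc0 : c = 0 := by
    have := tendsto_nhds_unique h1 hc.neg
    exact self_eq_neg.1 this
  exact hf.of_tendsto_zero (hc0 ▸ hc)

lemma of_odd (hf : IsEllipticLE L (2 * n + 2) f) (hs : ∀ v ∉ L.lattice, f (-v) = -f v) :
    IsEllipticLE L (2 * n + 1) f :=
  hf.of_parity (s := -1) (by simpa using hs) (by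
    rw [show 2 * n + 1 + 1 = 2 * (n + 1) by ring, pow_mul]; simp)

/-- **Liouville's theorem** for elliptic functions. -/
theorem eq_const (hf : IsEllipticLE L 0 f) : ∃ c, ∀ v ∉ L.lattice, f v = c := by
  classical
  obtain ⟨c, hc⟩ := hf.exists_tendsto
  simp only [pow_zero, one_mul] at hc
  -- The arbitrary values of `f` on the lattice are replaced by the limit at `0`; the result is
  -- entire and periodic, hence bounded.
  set g : ℂ → ℂ := fun v => if v ∈ L.lattice then c else f v with hg
  have hper : ∀ v, ∀ l ∈ L.lattice, g (v + l) = g v := by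
    intro v l hl
    simp only [hg, L.lattice.add_mem_iff_left hl, hf.periodic v l hl]
  have hd' : ∀ v ∉ L.lattice, DifferentiableAt ℂ g v := by
    intro v hv
    refine (hf.differentiableAt v hv).congr_of_eventuallyEq ?_
    filter_upwards [L.isClosed_lattice.isOpen_compl.mem_nhds hv] with w hw
    exact if_neg hw
  have hd0 : DifferentiableAt ℂ g 0 := by
    refine (Complex.analyticAt_of_differentiable_on_punctured_nhds_of_continuousAt ?_
        ?_).differentiableAt
    · filter_upwards [eventually_notMem_lattice L] with v hv
      exact hd' v hv
    · rw [continuousAt_iff_punctured_nhds]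
      simp only [hg, zero_mem, if_true]
      refine hc.congr' ?_
      filter_upwards [eventually_notMem_lattice L] with v hv
      exact (if_neg hv).symm
  have hd : Differentiable ℂ g := by
    intro v
    by_cases hv : v ∈ L.lattice
    · have h1 : g = g ∘ fun w => w - v := by
        ext w
        simpa [sub_eq_add_neg] using (hper w (-v) (neg_mem hv)).symm
      rw [h1]
      refine DifferentiableAt.comp v ?_ (by fun_prop)
      simpa using hd0
    · exact hd' v hv
  obtain ⟨k, hk⟩ := hd.exists_const_forall_eq_of_bounded
    (IsZLattice.isCompact_range_of_periodic L.lattice g hd.continuous hper).isBounded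
  exact ⟨k, fun v hv => by rw [← hk v]; exact (if_neg hv).symm⟩

end IsEllipticLE

/-! ### Infinite products and the product model of `θ₁` -/

/-- The entire function `∏ (1 - qⁿ x)`, product over `n ≥ 0`. -/
noncomputable def qProd (q x : ℂ) : ℂ := ∏' n : ℕ, (1 + -(q ^ n * x))

section qProd

variable {q : ℂ}

lemma summable_norm_qProd (hq : ‖q‖ < 1) (x : ℂ) : Summable fun n : ℕ => ‖-(q ^ n * x)‖ := by
  simpa using (summable_geometric_of_lt_one (norm_nonneg q) hq).mul_right ‖x‖

lemma qProd_eq (hq : ‖q‖ < 1) (x : ℂ) : qProd q x = (1 - x) * qProd q (q * x) := by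
  have h (x : ℂ) : Multipliable fun n : ℕ => 1 + -(q ^ n * x) :=
    multipliable_one_add_of_summable (summable_norm_qProd hq x)
  have h2 : Multipliable fun n : ℕ => 1 + -(q ^ (n + 1) * x) := by
    refine (h (q * x)).congr fun n => by ring
  have h3 := tprod_eq_zero_mul' (f := fun n : ℕ => 1 + -(q ^ n * x)) h2
  have h4 : ∏' n : ℕ, (1 + -(q ^ (n + 1) * x)) = qProd q (q * x) :=
    tprod_congr fun n => by ring
  refine h3.trans ?_
  rw [h4]
  ring

lemma qProd_ne_zero (hq : ‖q‖ < 1) {x : ℂ} (hx : ∀ n : ℕ, q ^ n * x ≠ 1) : qProd q x ≠ 0 := by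
  refine tprod_one_add_ne_zero_of_summable (fun n h => hx n ?_) (summable_norm_qProd hq x)
  linear_combination -h

lemma differentiable_qProd (hq : ‖q‖ < 1) : Differentiable ℂ (qProd q) := by
  intro x
  have h := Summable.hasProdLocallyUniformlyOn_nat_one_add (K := Metric.ball (0 : ℂ) (‖x‖ + 1))
    (f := fun n x => -(q ^ n * x)) Metric.isOpen_ball
    ((summable_geometric_of_lt_one (norm_nonneg q) hq).mul_right (‖x‖ + 1))
    (.of_forall fun n y hy => by
      rw [norm_neg, norm_mul, norm_pow]
      gcongr
      simpa using (mem_ball_zero_iff.1 hy).le) (fun n => by fun_prop)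
  refine (h.differentiableOn (.of_forall fun s => ?_) Metric.isOpen_ball).differentiableAt
    (Metric.isOpen_ball.mem_nhds (by simp))
  exact DifferentiableOn.fun_finsetProd fun i _ => by fun_prop

end qProd

open Complex in
/-- The product side of the triple product formula for `θ₁`, up to a constant. -/
noncomputable def thetaProd (τ : ℍ) (v : ℂ) : ℂ :=
  exp (-(I * π * v)) * (qProd (exp (2 * π * I * τ)) (exp (2 * π * I * v)) *
    qProd (exp (2 * π * I * τ)) (exp (2 * π * I * (τ - v))))

section thetaProd
open Complex
variable (τ : ℍ)

lemma norm_nome_lt_one : ‖exp (2 * π * I * τ)‖ < 1 := UpperHalfPlane.norm_exp_two_pi_I_lt_one τ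

lemma differentiable_thetaProd : Differentiable ℂ (thetaProd τ) := by
  have h := differentiable_qProd (norm_nome_lt_one τ)
  unfold thetaProd
  fun_prop

lemma exp_two_pi_add_one (v : ℂ) : exp (2 * π * I * (v + 1)) = exp (2 * π * I * v) := by
  rw [mul_add, mul_one, exp_add, exp_two_pi_mul_I, mul_one]

lemma thetaProd_add_one (v : ℂ) : thetaProd τ (v + 1) = -thetaProd τ v := by
  have h1 := exp_two_pi_add_one v
  have h2 := exp_two_pi_add_one (τ - (v + 1))
  rw [show (τ : ℂ) - (v + 1) + 1 = τ - v by ring] at h2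
  rw [thetaProd, thetaProd, h1, h2, show -(I * π * (v + 1)) = -(I * π * v) + -(π * I) by ring,
    exp_add, exp_neg (π * I), exp_pi_mul_I]
  ring

lemma thetaProd_add_tau (v : ℂ) :
    thetaProd τ (v + τ) = -exp (-(I * π * τ) - 2 * π * I * v) * thetaProd τ v := by
  have hq := norm_nome_lt_one τ
  have h1 := qProd_eq hq (exp (2 * π * I * v))
  have h2 := qProd_eq hq (exp (2 * π * I * -v))
  rw [← exp_add] at h1 h2
  rw [show 2 * π * I * (τ : ℂ) + 2 * π * I * v = 2 * π * I * (v + τ) by ring] at h1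
  rw [show 2 * π * I * (τ : ℂ) + 2 * π * I * -v = 2 * π * I * (τ - v) by ring] at h2
  rw [thetaProd, thetaProd, show (τ : ℂ) - (v + τ) = -v by ring, h1, h2, mul_neg,
    show -(I * π * (v + τ)) = -(I * π * v) + -(I * π * τ) by ring, exp_add, exp_sub,
    exp_neg (2 * π * I * v)]
  have := exp_ne_zero (2 * π * I * v)
  field_simp
  ring

lemma thetaProd_ne_zero {v : ℂ} (hv : v ∉ (periods τ).lattice) : thetaProd τ v ≠ 0 := by
  have key (n : ℤ) (m : ℤ) (h : n * (τ : ℂ) + v = m) : False := by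
    refine hv (PeriodPair.mem_lattice.2 ⟨m, -n, ?_⟩)
    simp only [periods]
    push_cast
    linear_combination -h
  refine mul_ne_zero (exp_ne_zero _) (mul_ne_zero ?_ ?_)
  · refine qProd_ne_zero (norm_nome_lt_one τ) fun n h => ?_
    rw [← exp_nat_mul, ← exp_add, exp_eq_one_iff] at h
    obtain ⟨m, hm⟩ := h
    refine key n m ?_
    have := two_pi_I_ne_zero
    apply mul_left_cancel₀ this
    push_cast
    linear_combination hm
  · refine qProd_ne_zero (norm_nome_lt_one τ) fun n h => ?_
    rw [← exp_nat_mul, ← exp_add, exp_eq_one_iff] at h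
    obtain ⟨m, hm⟩ := h
    refine key (-(n + 1)) (-m) ?_
    have := two_pi_I_ne_zero
    apply mul_left_cancel₀ this
    push_cast
    linear_combination -hm

lemma thetaProd_zero : thetaProd τ 0 = 0 := by
  rw [thetaProd, mul_zero, mul_zero, exp_zero, qProd_eq (norm_nome_lt_one τ) 1]
  simp

lemma deriv_thetaProd_zero_ne_zero : deriv (thetaProd τ) 0 ≠ 0 := by
  have hq := norm_nome_lt_one τ
  set q := exp (2 * π * I * τ) with hqdef
  have hd := differentiable_qProd hq
  have hE : qProd q q ≠ 0 := by
    refine qProd_ne_zero hq fun n h => ?_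
    have h1 : ‖q ^ n * q‖ = 1 := by rw [h, norm_one]
    rw [← pow_succ, norm_pow] at h1
    exact (pow_lt_one₀ (norm_nonneg q) hq n.succ_ne_zero).ne h1
  set B : ℂ → ℂ := fun v => exp (-(I * π * v)) * (qProd q (q * exp (2 * π * I * v)) *
    qProd q (exp (2 * π * I * (τ - v)))) with hB
  have hP : thetaProd τ = fun v => (1 - exp (2 * π * I * v)) * B v := by
    ext v
    rw [thetaProd, qProd_eq hq (exp (2 * π * I * v)), hB]
    ring
  have hBd : Differentiable ℂ B := by
    simp only [hB]
    fun_prop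
  have h1 : HasDerivAt (fun v : ℂ => 1 - exp (2 * π * I * v)) (-(2 * π * I)) 0 := by
    have := (((hasDerivAt_id (0 : ℂ)).const_mul (2 * π * I)).cexp).const_sub 1
    simpa using this
  have h2 := h1.mul (hBd 0).hasDerivAt
  have h3 : deriv (thetaProd τ) 0 = -(2 * π * I) * (qProd q q * qProd q q) := by
    rw [hP]
    refine h2.deriv.trans ?_
    simp [hB, ← hqdef]
  rw [h3]
  exact mul_ne_zero (neg_ne_zero.2 two_pi_I_ne_zero) (mul_ne_zero hE hE)

end thetaProd

/-! ### Quasi-periodicity and zeros of `θ₁` -/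

section theta1
open Complex
variable (τ : ℍ)

lemma differentiable_theta1 : Differentiable ℂ (theta1 τ) := by
  intro v
  have h := differentiableAt_jacobiTheta₂_fst (v + 1 / 2 + τ / 2) τ.im_pos
  have h2 : DifferentiableAt ℂ (fun v : ℂ => jacobiTheta₂ (v + 1 / 2 + τ / 2) τ) v :=
    h.comp (f := fun v : ℂ => v + 1 / 2 + τ / 2) v (by fun_prop)
  exact DifferentiableAt.mul (by fun_prop) h2

lemma theta1_add_one (v : ℂ) : theta1 τ (v + 1) = -theta1 τ v := by
  rw [theta1, theta1, show v + 1 + 1 / 2 + (τ : ℂ) / 2 = v + 1 / 2 + τ / 2 + 1 by ring,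
    jacobiTheta₂_add_left, show I * π * τ / 4 + I * π * (v + 1 + 1 / 2) =
      I * π * τ / 4 + I * π * (v + 1 / 2) + π * I by ring, exp_add, exp_pi_mul_I]
  ring

lemma theta1_add_tau (v : ℂ) :
    theta1 τ (v + τ) = -exp (-(I * π * τ) - 2 * π * I * v) * theta1 τ v := by
  rw [theta1, theta1, show v + τ + 1 / 2 + (τ : ℂ) / 2 = v + 1 / 2 + τ / 2 + τ by ring,
    jacobiTheta₂_add_left', ← mul_assoc, ← mul_assoc, ← neg_one_mul (exp _), ← exp_pi_mul_I,
    ← exp_add, ← exp_add, ← exp_add]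
  congr 1
  rw [exp_eq_exp_iff_exists_int]
  exact ⟨-1, by push_cast; ring⟩

lemma theta1_neg (v : ℂ) : theta1 τ (-v) = -theta1 τ v := by
  have h : jacobiTheta₂ (-v + 1 / 2 + τ / 2) τ = jacobiTheta₂ (v - 1 / 2 - τ / 2) τ := by
    rw [← jacobiTheta₂_neg_left]
    congr 1
    ring
  rw [theta1, theta1, h, show v + 1 / 2 + (τ : ℂ) / 2 = v - 1 / 2 - τ / 2 + 1 + τ by ring,
    jacobiTheta₂_add_left', jacobiTheta₂_add_left, ← mul_assoc, ← exp_add, ← neg_one_mul (_ * _),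
    ← exp_pi_mul_I, ← mul_assoc, ← exp_add]
  congr 1
  rw [exp_eq_exp_iff_exists_int]
  exact ⟨0, by push_cast; ring⟩

lemma theta1_zero : theta1 τ 0 = 0 := by
  have := theta1_neg τ 0
  rwa [neg_zero, self_eq_neg] at this

lemma periodic_of_add_one_of_add_tau {f : ℂ → ℂ} (h1 : ∀ v, f (v + 1) = f v)
    (h2 : ∀ v, f (v + τ) = f v) (v l : ℂ) (hl : l ∈ (periods τ).lattice) : f (v + l) = f v := by
  obtain ⟨m, n, rfl⟩ := PeriodPair.mem_lattice.1 hl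
  have e1 : Function.Periodic f 1 := h1
  have e2 : Function.Periodic f (τ : ℂ) := h2
  simp only [periods, mul_one]
  rw [← add_assoc, e2.int_mul n, ← mul_one (m : ℂ), e1.int_mul m]

/-- Numerator and denominator have the same multipliers. The denominator vanishes only on the
lattice, with a simple zero at `0`, where `θ₁` vanishes too; so the quotient has no pole. -/
lemma isEllipticLE_theta1_div_thetaProd :
    IsEllipticLE (periods τ) 0 (fun v => theta1 τ v / thetaProd τ v) := by
  refine IsEllipticLE.of_tendsto_zero ⟨?_, ?_, ?_⟩ ?_
  · refine periodic_of_add_one_of_add_tau τ (f := fun v => theta1 τ v / thetaProd τ v)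
      (fun v => ?_) (fun v => ?_)
    · rw [theta1_add_one, thetaProd_add_one, neg_div_neg_eq]
    · rw [theta1_add_tau, thetaProd_add_tau, mul_div_mul_left _ _ (neg_ne_zero.2 (exp_ne_zero _))]
  · intro v hv
    exact (differentiable_theta1 τ v).div (differentiable_thetaProd τ v) (thetaProd_ne_zero τ hv)
  all_goals
    have h : Tendsto (fun v => v ^ (0 + 1) * (theta1 τ v / thetaProd τ v)) (𝓝[≠] 0) (𝓝 0) := by
      have h1 : Tendsto (theta1 τ) (𝓝[≠] 0) (𝓝 0) := by
        have := (differentiable_theta1 τ).continuous.tendsto 0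
        rw [theta1_zero] at this
        exact this.mono_left nhdsWithin_le_nhds
      have h2 := (differentiable_thetaProd τ 0).hasDerivAt.tendsto_slope
      have h3 := h1.mul (h2.inv₀ (deriv_thetaProd_zero_ne_zero τ))
      rw [zero_mul] at h3
      refine h3.congr fun v => ?_
      rw [slope_def_field, thetaProd_zero, sub_zero, sub_zero, inv_div]
      ring
    first | exact h | exact h.isBigO_one ℝ

/-- Liouville gives the identity off the lattice, and density extends it. The value of `c` is not
computed; that `c ≠ 0` is read off from any point where `θ₁` does not vanish, which is why later
lemmas carry a witness `theta1 τ u ≠ 0`, eventually supplied by `𝒳`. -/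
lemma exists_theta1_eq : ∃ c, ∀ v, theta1 τ v = c * thetaProd τ v := by
  obtain ⟨c, hc⟩ := (isEllipticLE_theta1_div_thetaProd τ).eq_const
  have hoff (v) (hv : v ∉ (periods τ).lattice) : theta1 τ v = c * thetaProd τ v := by
    rw [← hc v hv, div_mul_cancel₀ _ (thetaProd_ne_zero τ hv)]
  have hcount : Countable (periods τ).lattice :=
    (periods τ).latticeEquivProd.injective.countable
  have hdense : Dense ((periods τ).lattice : Set ℂ)ᶜ :=
    (Set.countable_coe_iff.1 hcount).dense_compl ℝ
  exact ⟨c, congrFun (Continuous.ext_on hdense (differentiable_theta1 τ).continuous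
    ((differentiable_thetaProd τ).continuous.const_mul c) hoff)⟩

lemma theta1_of_mem {v : ℂ} (hv : v ∈ (periods τ).lattice) : theta1 τ v = 0 := by
  classical
  -- The multipliers never vanish, so the indicator of the zero set of `θ₁` is genuinely periodic.
  have := periodic_of_add_one_of_add_tau τ
    (f := fun v => if theta1 τ v = 0 then 1 else 0) (fun v => by simp [theta1_add_one])
    (fun v => by simp [theta1_add_tau]) 0 v hv
  simpa [theta1_zero] using this

variable {τ}

lemma theta1_eq_zero_iff {w : ℂ} (hw : theta1 τ w ≠ 0) {v : ℂ} :
    theta1 τ v = 0 ↔ v ∈ (periods τ).lattice := by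
  obtain ⟨c, hc⟩ := exists_theta1_eq τ
  refine ⟨fun h => ?_, theta1_of_mem τ⟩
  by_contra hv
  rw [hc] at h hw
  exact mul_ne_zero (left_ne_zero_of_mul hw) (thetaProd_ne_zero τ hv) h

lemma deriv_theta1_zero_ne_zero {w : ℂ} (hw : theta1 τ w ≠ 0) : deriv (theta1 τ) 0 ≠ 0 := by
  obtain ⟨c, hc⟩ := exists_theta1_eq τ
  rw [funext hc, deriv_const_mul _ (differentiable_thetaProd τ 0)]
  rw [hc] at hw
  exact mul_ne_zero (left_ne_zero_of_mul hw) (deriv_thetaProd_zero_ne_zero τ)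

end theta1

/-! ### Leading terms of `℘` and `℘'` at the origin -/

lemma IsEllipticLE.of_tendsto_pow_mul {L : PeriodPair} {n : ℕ} {f : ℂ → ℂ} {c : ℂ}
    (h1 : ∀ v, ∀ l ∈ L.lattice, f (v + l) = f v) (h2 : ∀ v ∉ L.lattice, DifferentiableAt ℂ f v)
    (h3 : Tendsto (fun v => v ^ n * f v) (𝓝[≠] 0) (𝓝 c)) : IsEllipticLE L n f :=
  ⟨h1, h2, h3.isBigO_one ℝ⟩

section weierstrass

variable (L : PeriodPair)

lemma tendsto_sq_mul_weierstrassP :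
    Tendsto (fun v => v ^ 2 * L.weierstrassP v) (𝓝[≠] 0) (𝓝 1) := by
  have hc : ContinuousAt (fun v : ℂ => v ^ 2 * L.weierstrassPExcept 0 v + 1) 0 :=
    ((continuousAt_id.pow 2).mul (L.analyticAt_weierstrassPExcept 0).continuousAt).add_const 1
  have h := hc.tendsto.mono_left (nhdsWithin_le_nhds (s := {0}ᶜ))
  simp only [ne_eq, OfNat.ofNat_ne_zero, not_false_eq_true, zero_pow, zero_mul, zero_add] at h
  refine h.congr' ?_
  filter_upwards [self_mem_nhdsWithin] with v hv
  have hv : v ≠ 0 := hv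
  have := L.weierstrassPExcept_def 0 v
  simp only [ZeroMemClass.coe_zero] at this
  rw [this]
  field_simp
  simp
  ring

lemma tendsto_cube_mul_derivWeierstrassP :
    Tendsto (fun v => v ^ 3 * L.derivWeierstrassP v) (𝓝[≠] 0) (𝓝 (-2)) := by
  have hc : ContinuousAt (fun v : ℂ => v ^ 3 * L.derivWeierstrassPExcept 0 v - 2) 0 :=
    ((continuousAt_id.pow 3).mul (L.analyticAt_derivWeierstrassPExcept 0).continuousAt).sub_const 2
  have h := hc.tendsto.mono_left (nhdsWithin_le_nhds (s := {0}ᶜ))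
  simp only [ne_eq, OfNat.ofNat_ne_zero, not_false_eq_true, zero_pow, zero_mul, zero_sub] at h
  refine h.congr' ?_
  filter_upwards [self_mem_nhdsWithin] with v hv
  have hv : v ≠ 0 := hv
  have := L.derivWeierstrassPExcept_def 0 v
  simp only [ZeroMemClass.coe_zero] at this
  rw [this]
  field_simp
  simp
  ring

lemma isEllipticLE_weierstrassP : IsEllipticLE L 2 L.weierstrassP :=
  .of_tendsto_pow_mul (fun v l hl => L.weierstrassP_add_coe v ⟨l, hl⟩)
    (fun _ hv => (L.analyticOnNhd_weierstrassP _ hv).differentiableAt)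
    (tendsto_sq_mul_weierstrassP L)

lemma isEllipticLE_derivWeierstrassP : IsEllipticLE L 3 L.derivWeierstrassP :=
  .of_tendsto_pow_mul (fun v l hl => L.derivWeierstrassP_add_coe v ⟨l, hl⟩)
    (fun _ hv => (L.analyticOnNhd_derivWeierstrassP _ hv).differentiableAt)
    (tendsto_cube_mul_derivWeierstrassP L)

end weierstrass

/-! ### Theta factorization of `℘(v) - ℘(w)` and its consequences -/

section factorization
open Complex

variable {τ : ℍ} {u : ℂ}

lemma tendsto_theta1_div_id :
    Tendsto (fun v => theta1 τ v / v) (𝓝[≠] 0) (𝓝 (deriv (theta1 τ) 0)) := by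
  refine (differentiable_theta1 τ 0).hasDerivAt.tendsto_slope.congr fun v => ?_
  rw [slope_def_field, theta1_zero, sub_zero, sub_zero]

lemma tendsto_id_div_theta1 (hu : theta1 τ u ≠ 0) :
    Tendsto (fun v => v / theta1 τ v) (𝓝[≠] 0) (𝓝 (deriv (theta1 τ) 0)⁻¹) := by
  refine (tendsto_theta1_div_id.inv₀ (deriv_theta1_zero_ne_zero hu)).congr fun v => ?_
  rw [inv_div]

lemma tendsto_thetaQuot (hu : theta1 τ u ≠ 0) (w : ℂ) :
    Tendsto (fun v => v ^ 2 * (theta1 τ (v + w) * theta1 τ (v - w) / theta1 τ v ^ 2)) (𝓝[≠] 0)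
      (𝓝 (-(theta1 τ w / deriv (theta1 τ) 0) ^ 2)) := by
  have h1 := (tendsto_id_div_theta1 hu).pow 2
  have h2 : Tendsto (fun v => theta1 τ (v + w) * theta1 τ (v - w)) (𝓝[≠] 0)
      (𝓝 (theta1 τ w * theta1 τ (-w))) := by
    have hc : Continuous fun v => theta1 τ (v + w) * theta1 τ (v - w) := by
      have := (differentiable_theta1 τ).continuous
      fun_prop
    simpa using (hc.tendsto 0).mono_left (nhdsWithin_le_nhds (s := {0}ᶜ))
  have h3 := h1.mul h2
  rw [theta1_neg] at h3
  convert! h3 using 1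
  · ext v
    ring
  · congr 1
    ring

lemma isEllipticLE_thetaQuot (hu : theta1 τ u ≠ 0) (w : ℂ) :
    IsEllipticLE (periods τ) 2
      (fun v => theta1 τ (v + w) * theta1 τ (v - w) / theta1 τ v ^ 2) := by
  refine .of_tendsto_pow_mul ?_ ?_ (tendsto_thetaQuot hu w)
  · refine periodic_of_add_one_of_add_tau τ
      (f := fun v => theta1 τ (v + w) * theta1 τ (v - w) / theta1 τ v ^ 2) (fun v => ?_)
      (fun v => ?_)
    · rw [show v + 1 + w = v + w + 1 by ring, show v + 1 - w = v - w + 1 by ring, theta1_add_one,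
        theta1_add_one, theta1_add_one, neg_mul_neg, neg_sq]
    · rw [show v + τ + w = v + w + τ by ring, show v + τ - w = v - w + τ by ring, theta1_add_tau,
        theta1_add_tau, theta1_add_tau, mul_mul_mul_comm, mul_pow, neg_mul_neg, neg_sq,
        ← exp_add, ← exp_nat_mul]
      rw [show -(I * π * τ) - 2 * π * I * (v + w) + (-(I * π * τ) - 2 * π * I * (v - w)) =
        ((2 : ℕ) : ℂ) * (-(I * π * τ) - 2 * π * I * v) by push_cast; ring]
      exact mul_div_mul_left _ _ (exp_ne_zero _)
  · intro v hv
    have hd := differentiable_theta1 τ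
    have h0 : theta1 τ v ^ 2 ≠ 0 := pow_ne_zero 2 ((theta1_eq_zero_iff hu).not.2 hv)
    refine DifferentiableAt.fun_div (by fun_prop) (by fun_prop) h0

/-- The factorization of `℘(v) - ℘(w)` through theta functions. -/
theorem theta1_mul_theta1_div_sq (hu : theta1 τ u ≠ 0) {v w : ℂ} (hv : v ∉ (periods τ).lattice)
    (hw : w ∉ (periods τ).lattice) :
    theta1 τ (v + w) * theta1 τ (v - w) / theta1 τ v ^ 2 =
      -(theta1 τ w / deriv (theta1 τ) 0) ^ 2 * (wp τ v - wp τ w) := by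
  set c := -(theta1 τ w / deriv (theta1 τ) 0) ^ 2
  have h1 := IsEllipticLE.of_tendsto (isEllipticLE_thetaQuot hu w)
    (isEllipticLE_weierstrassP (periods τ)) (tendsto_thetaQuot hu w)
    (tendsto_sq_mul_weierstrassP (periods τ)) one_ne_zero
  rw [div_one] at h1
  have h2 := IsEllipticLE.of_parity h1 (s := 1) (fun v _ => by
    rw [PeriodPair.weierstrassP_neg, one_mul, theta1_neg, show -v + w = -(v - w) by ring,
      show -v - w = -(v + w) by ring, theta1_neg, theta1_neg]
    ring) (by norm_num)
  obtain ⟨k, hk⟩ := h2.eq_const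
  -- At `v = w` both sides vanish, so the Liouville constant `k` is determined without expanding
  -- further at `0`.
  have h3 := hk w hw
  have h4 := hk v hv
  rw [sub_self, theta1_zero] at h3
  simp only [wp]
  linear_combination h4 - h3

lemma add_mem_or_sub_mem_of_wp_eq (hu : theta1 τ u ≠ 0) {v w : ℂ} (hv : v ∉ (periods τ).lattice)
    (hw : w ∉ (periods τ).lattice) (h : wp τ v = wp τ w) :
    v + w ∈ (periods τ).lattice ∨ v - w ∈ (periods τ).lattice := by
  have h1 := theta1_mul_theta1_div_sq hu hv hw
  rw [h, sub_self, mul_zero, div_eq_zero_iff, mul_eq_zero] at h1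
  have h0 : theta1 τ v ^ 2 ≠ 0 := pow_ne_zero 2 ((theta1_eq_zero_iff hu).not.2 hv)
  rw [← theta1_eq_zero_iff hu, ← theta1_eq_zero_iff hu]
  exact h1.resolve_right h0

lemma isHalfPeriod_iff {v : ℂ} : IsHalfPeriod τ v ↔ 2 * v ∈ (periods τ).lattice := by
  rw [PeriodPair.mem_lattice]
  simp only [IsHalfPeriod, periods, mul_one, eq_comm]

lemma notMem_of_not_isHalfPeriod {v : ℂ} (hv : ¬ IsHalfPeriod τ v) : v ∉ (periods τ).lattice := by
  intro h
  rw [isHalfPeriod_iff, two_mul] at hv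
  exact hv (add_mem h h)

lemma hasDerivAt_wp {v : ℂ} (hv : v ∉ (periods τ).lattice) :
    HasDerivAt (wp τ) ((periods τ).derivWeierstrassP v) v := by
  have h := ((periods τ).analyticOnNhd_weierstrassP v hv).differentiableAt.hasDerivAt
  rwa [PeriodPair.deriv_weierstrassP] at h

/-- Differentiating the factorization at `v = w` expresses a multiple of `℘'(w)` as `θ₁'(0) θ₁(2w) /
θ₁(w)²`, and `2w` is not a period. -/
lemma derivWeierstrassP_ne_zero (hu : theta1 τ u ≠ 0) {w : ℂ} (hw : ¬ IsHalfPeriod τ w) :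
    (periods τ).derivWeierstrassP w ≠ 0 := by
  have hw' := notMem_of_not_isHalfPeriod hw
  have hd := differentiable_theta1 τ
  have h0 : theta1 τ w ≠ 0 := (theta1_eq_zero_iff hu).not.2 hw'
  set c := -(theta1 τ w / deriv (theta1 τ) 0) ^ 2
  have h1 : HasDerivAt (fun v => c * (wp τ v - wp τ w))
      (c * (periods τ).derivWeierstrassP w) w := ((hasDerivAt_wp hw').sub_const _).const_mul c
  have h2 : HasDerivAt (fun v => theta1 τ (v - w)) (deriv (theta1 τ) 0) w := by
    have h : HasDerivAt (theta1 τ) (deriv (theta1 τ) 0) (w - w) := by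
      rw [sub_self]; exact (hd 0).hasDerivAt
    exact HasDerivAt.comp_sub_const w w h
  have h3 : DifferentiableAt ℂ (fun v => theta1 τ (v + w) / theta1 τ v ^ 2) w :=
    DifferentiableAt.fun_div (by fun_prop) (by fun_prop) (pow_ne_zero 2 h0)
  have h4 := h2.mul h3.hasDerivAt
  rw [sub_self, theta1_zero, zero_mul, add_zero] at h4
  have h5 : (fun v => c * (wp τ v - wp τ w)) =ᶠ[𝓝 w]
      ((fun v => theta1 τ (v - w)) * fun v => theta1 τ (v + w) / theta1 τ v ^ 2) := by
    filter_upwards [(periods τ).isClosed_lattice.isOpen_compl.mem_nhds hw'] with v hv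
    rw [← theta1_mul_theta1_div_sq hu hv hw', Pi.mul_apply]
    ring
  have h6 := h1.unique (h4.congr_of_eventuallyEq h5)
  intro h
  rw [h, mul_zero] at h6
  refine mul_ne_zero (deriv_theta1_zero_ne_zero hu) (div_ne_zero ?_ (pow_ne_zero 2 h0)) h6.symm
  rw [ne_eq, theta1_eq_zero_iff hu, ← two_mul, ← isHalfPeriod_iff]
  exact hw

end factorization

/-! ### Odd elliptic functions are `℘'` times polynomials in `℘` -/

section odd

variable {τ : ℍ} {u : ℂ} {f : ℂ → ℂ}

lemma wp_half_ne (hu : theta1 τ u ≠ 0) : wp τ (1 / 2) ≠ wp τ (τ / 2) := by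
  intro h
  have h1 := (periods τ).ω₁_div_two_notMem_lattice
  have h2 := (periods τ).ω₂_div_two_notMem_lattice
  have key (a : ℚ) (ha : a.den ≠ 1) (h : (1 : ℂ) / 2 + a * τ ∈ (periods τ).lattice) :
      False := by
    have := ((periods τ).mul_ω₁_add_mul_ω₂_mem_lattice (α := 1 / 2) (β := a)).1
      (by simpa [periods] using h)
    exact ha this.2
  rcases add_mem_or_sub_mem_of_wp_eq hu h1 h2 h with h | h
  · refine key (1 / 2) (by norm_num) ?_
    simpa [periods, div_eq_inv_mul] using h
  · refine key (-1 / 2) (by norm_num) ?_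
    simpa [periods, div_eq_inv_mul, sub_eq_add_neg] using h

/-- An odd elliptic function with at most simple poles, all at lattice points, vanishes. -/
lemma IsEllipticLE.eq_zero_of_odd (hu : theta1 τ u ≠ 0) (hf : IsEllipticLE (periods τ) 1 f)
    (hodd : ∀ v ∉ (periods τ).lattice, f (-v) = -f v) : ∀ v ∉ (periods τ).lattice, f v = 0 := by
  have hhalf (w : ℂ) (hw : w ∉ (periods τ).lattice) (h2 : 2 * w ∈ (periods τ).lattice) :
      f w = 0 := by
    have h1 := hf.periodic (-w) (2 * w) h2
    rw [show -w + 2 * w = w by ring, hodd w hw] at h1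
    exact self_eq_neg.1 h1
  obtain ⟨c, hc⟩ := hf.exists_tendsto
  have hsq : IsEllipticLE (periods τ) 2 (fun v => f v * f v) := hf.mul hf
  -- With `c` the residue of `f`, the function `f² - c² ℘` is even with at most a simple pole, hence
  -- constant. Since `f` vanishes at the half-periods `1/2` and `τ/2`, where `℘` takes different
  -- values, `c = 0`; then `f²` is constant and vanishes at a half-period.
  have h1 := IsEllipticLE.of_tendsto hsq (isEllipticLE_weierstrassP (periods τ)) (a := c * c)
    ((hc.mul hc).congr fun v => by ring)
    (tendsto_sq_mul_weierstrassP (periods τ)) one_ne_zero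
  have h2 := IsEllipticLE.of_parity h1 (s := 1) (fun v hv => by
    rw [PeriodPair.weierstrassP_neg, one_mul, hodd v hv]
    ring) (by norm_num)
  obtain ⟨k, hk⟩ := h2.eq_const
  have hw1 := (periods τ).ω₁_div_two_notMem_lattice
  have hw2 := (periods τ).ω₂_div_two_notMem_lattice
  have e1 := hk _ hw1
  have e2 := hk _ hw2
  rw [hhalf _ hw1 (by simpa [mul_div_cancel₀] using (periods τ).ω₁_mem_lattice)] at e1
  rw [hhalf _ hw2 (by simpa [mul_div_cancel₀] using (periods τ).ω₂_mem_lattice)] at e2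
  have hne := wp_half_ne hu
  have hcc : c * c = 0 := by
    have : (c * c) * (wp τ (1 / 2) - wp τ (τ / 2)) = 0 := by
      simp only [wp]
      simp only [periods, div_one] at e1 e2 ⊢
      linear_combination e2 - e1
    exact (mul_eq_zero.1 this).resolve_right (sub_ne_zero.2 hne)
  intro v hv
  have e3 := hk v hv
  rw [hcc] at e1 e3
  have : f v * f v = 0 := by linear_combination e3 - e1
  exact mul_self_eq_zero.1 this

/-- An odd elliptic function with poles at the lattice points only is `℘'` times a polynomial
in `℘`. -/
theorem IsEllipticLE.exists_polynomial_of_odd (hu : theta1 τ u ≠ 0) (k : ℕ) :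
    ∀ {f : ℂ → ℂ}, IsEllipticLE (periods τ) (2 * k + 3) f →
      (∀ v ∉ (periods τ).lattice, f (-v) = -f v) →
      ∃ p : Polynomial ℂ, p.natDegree ≤ k ∧
        ∀ v ∉ (periods τ).lattice, f v = (periods τ).derivWeierstrassP v * p.eval (wp τ v) := by
  have step (k : ℕ) {f : ℂ → ℂ} (hf : IsEllipticLE (periods τ) (2 * k + 3) f)
      (hodd : ∀ v ∉ (periods τ).lattice, f (-v) = -f v) : ∃ c : ℂ,
        IsEllipticLE (periods τ) (2 * k + 1)
          (fun v => f v - c * ((periods τ).derivWeierstrassP v * wp τ v ^ k)) := by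
    obtain ⟨a, ha⟩ := hf.exists_tendsto
    have hg := ((isEllipticLE_weierstrassP (periods τ)).pow k).mul
      (isEllipticLE_derivWeierstrassP (periods τ))
    rw [mul_comm k 2] at hg
    have hb := ((tendsto_sq_mul_weierstrassP (periods τ)).pow k).mul
      (tendsto_cube_mul_derivWeierstrassP (periods τ))
    -- The leading coefficient of `℘^k ℘'` is `-2`. Subtracting a multiple removes the pole term of
    -- order `2k + 3`, and oddness then removes the term of order `2k + 2`.
    have h1 := hf.of_tendsto hg ha (b := 1 ^ k * -2) (hb.congr fun v => by ring) (by simp)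
    have h2 := IsEllipticLE.of_odd h1 (fun v hv => by
      rw [hodd v hv, PeriodPair.weierstrassP_neg, PeriodPair.derivWeierstrassP_neg]
      ring)
    refine ⟨a / (1 ^ k * -2), ?_⟩
    simpa only [wp, mul_comm] using h2
  have hoddg (k : ℕ) (c : ℂ) {f : ℂ → ℂ} (hodd : ∀ v ∉ (periods τ).lattice, f (-v) = -f v) :
      ∀ v ∉ (periods τ).lattice,
        f (-v) - c * ((periods τ).derivWeierstrassP (-v) * wp τ (-v) ^ k) =
          -(f v - c * ((periods τ).derivWeierstrassP v * wp τ v ^ k)) := by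
    intro v hv
    rw [hodd v hv, wp, wp, PeriodPair.weierstrassP_neg, PeriodPair.derivWeierstrassP_neg]
    ring
  induction k with
  | zero =>
    intro f hf hodd
    obtain ⟨c, hc⟩ := step 0 hf hodd
    have h0 := IsEllipticLE.eq_zero_of_odd hu hc (hoddg 0 c hodd)
    refine ⟨.C c, by simp, fun v hv => ?_⟩
    rw [Polynomial.eval_C]
    linear_combination h0 v hv
  | succ k ih =>
    intro f hf hodd
    obtain ⟨c, hc⟩ := step (k + 1) hf hodd
    obtain ⟨p, hp, hpe⟩ := ih hc (hoddg (k + 1) c hodd)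
    refine ⟨p + .C c * .X ^ (k + 1), ?_, fun v hv => ?_⟩
    · refine Polynomial.natDegree_add_le_of_degree_le (hp.trans k.le_succ) ?_
      exact Polynomial.natDegree_C_mul_X_pow_le _ _
    · simp only [Polynomial.eval_add, Polynomial.eval_mul, Polynomial.eval_C, Polynomial.eval_pow,
        Polynomial.eval_X]
      linear_combination hpe v hv

end odd

/-! ### The Szegő kernel, its sections, and the determinant of `Φ` -/

section szego
open Complex

/-- The multiplier system of the Szegő kernel together with the polar behaviour at the lattice:
`A` is holomorphic off the lattice and `v ^ n * A v → c` as `v → 0`. -/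
structure IsSection (τ : ℍ) (α β : ℝ) (n : ℕ) (c : ℂ) (A : ℂ → ℂ) : Prop where
  add_one : ∀ v, A (v + 1) = exp (2 * π * I * α) * A v
  add_tau : ∀ v, A (v + τ) = exp (2 * π * I * β) * A v
  differentiableAt : ∀ v ∉ (periods τ).lattice, DifferentiableAt ℂ A v
  tendsto : Tendsto (fun v => v ^ n * A v) (𝓝[≠] 0) (𝓝 c)

/-- The Szegő kernel depends on `v - w` only; this is its profile. -/
noncomputable def szegoProfile (τ : ℍ) (α β : ℝ) (v : ℂ) : ℂ :=
  exp (2 * I * π * α * v) * (deriv (theta1 τ) 0 * theta1 τ (v - chi τ α β) /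
    (theta1 τ (chi τ α β) * theta1 τ (-v)))

variable {τ : ℍ} {α β : ℝ}

lemma szego_eq (v w : ℂ) : szego τ α β v w = szegoProfile τ α β (v - w) := by
  rw [szego, szegoProfile, neg_sub]

lemma phi_zero_eq : phi τ α β 0 = szegoProfile τ α β := by
  ext v
  rw [phi, iteratedDeriv_zero, szego_eq, sub_zero]

lemma phi_one_eq (v : ℂ) : phi τ α β 1 v = -deriv (szegoProfile τ α β) v := by
  simp only [phi, iteratedDeriv_one, szego_eq]
  rw [deriv_comp_const_sub, sub_zero]

lemma notMem_neg {v : ℂ} (hv : v ∉ (periods τ).lattice) : -v ∉ (periods τ).lattice := by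
  simpa using hv

lemma isSection_szegoProfile (hχ : theta1 τ (chi τ α β) ≠ 0) :
    IsSection τ α β 1 1 (szegoProfile τ α β) where
  add_one v := by
    rw [szegoProfile, szegoProfile, theta1_neg, theta1_neg, theta1_add_one,
      show v + 1 - chi τ α β = v - chi τ α β + 1 by ring, theta1_add_one,
      show 2 * I * π * α * (v + 1) = 2 * π * I * α + 2 * I * π * α * v by ring, exp_add]
    simp only [mul_neg, div_neg, neg_div, neg_neg]
    ring
  add_tau v := by
    rw [szegoProfile, szegoProfile, theta1_neg, theta1_neg, theta1_add_tau,
      show v + τ - chi τ α β = v - chi τ α β + τ by ring, theta1_add_tau]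
    have h1 : exp (2 * I * π * α * (v + τ)) * exp (-(I * π * τ) - 2 * π * I * (v - chi τ α β)) =
        exp (2 * π * I * β) * exp (2 * I * π * α * v) * exp (-(I * π * τ) - 2 * π * I * v) := by
      rw [← exp_add, ← exp_add, ← exp_add]
      congr 1
      rw [chi]
      ring
    have h2 := exp_ne_zero (-(I * π * τ) - 2 * π * I * v)
    generalize exp (-(I * π * τ) - 2 * π * I * v) = e2 at *
    generalize exp (-(I * π * τ) - 2 * π * I * (v - chi τ α β)) = e1 at *
    calc _ = exp (2 * I * π * α * (v + τ)) * e1 * e2⁻¹ * (deriv (theta1 τ) 0 *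
          theta1 τ (v - chi τ α β) / (theta1 τ (chi τ α β) * -theta1 τ v)) := by
          simp only [div_eq_mul_inv, mul_inv, inv_neg, neg_mul, mul_neg]
          ring
      _ = _ := by
          rw [h1, mul_inv_cancel_right₀ h2]
          ring
  differentiableAt v hv := by
    have hd := differentiable_theta1 τ
    have h0 : theta1 τ (chi τ α β) * theta1 τ (-v) ≠ 0 :=
      mul_ne_zero hχ ((theta1_eq_zero_iff hχ).not.2 (notMem_neg hv))
    exact DifferentiableAt.fun_mul (by fun_prop)
      (DifferentiableAt.fun_div (by fun_prop) (by fun_prop) h0)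
  tendsto := by
    have h1 := tendsto_id_div_theta1 hχ
    have hd := (differentiable_theta1 τ).continuous
    have hc : Continuous fun v => exp (2 * I * π * α * v) *
        (deriv (theta1 τ) 0 * theta1 τ (v - chi τ α β) / theta1 τ (chi τ α β)) := by
      fun_prop
    have h2 := ((hc.tendsto 0).mono_left (nhdsWithin_le_nhds (s := {0}ᶜ))).mul h1
    have h3 := h2.neg
    rw [mul_zero, exp_zero, zero_sub, theta1_neg] at h3
    have h4 := deriv_theta1_zero_ne_zero hχ
    convert! h3 using 1
    · ext v
      rw [szegoProfile, theta1_neg, pow_one]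
      simp only [div_eq_mul_inv, mul_inv, inv_neg]
      ring
    · congr 1
      field_simp

/-- If `g` is the holomorphic extension of `vA` through `0`, then `-v² A' = vA - v g'` and `v g' →
0`, so the leading coefficient is unchanged. -/
lemma IsSection.neg_deriv {A : ℂ → ℂ} {c : ℂ} (hA : IsSection τ α β 1 c A) :
    IsSection τ α β 2 c (fun v => -deriv A v) where
  add_one v := by
    rw [← deriv_comp_add_const, funext hA.add_one, deriv_const_mul_field]
    ring
  add_tau v := by
    rw [← deriv_comp_add_const, funext hA.add_tau, deriv_const_mul_field]
    ring
  differentiableAt v hv := by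
    have hU := (periods τ).isClosed_lattice.isOpen_compl
    have h : DifferentiableOn ℂ A ((periods τ).lattice : Set ℂ)ᶜ :=
      fun w hw => (hA.differentiableAt w hw).differentiableWithinAt
    exact ((h.deriv hU).differentiableAt (hU.mem_nhds hv)).neg
  tendsto := by
    set g : ℂ → ℂ := Function.update (fun v => v ^ 1 * A v) 0 c with hg
    have hgne (v : ℂ) (hv : v ≠ 0) : g =ᶠ[𝓝 v] fun v => v ^ 1 * A v := by
      filter_upwards [isOpen_ne.mem_nhds hv] with w hw
      exact Function.update_of_ne hw _ _
    have hcont : ContinuousAt g 0 := continuousAt_update_same.2 hA.tendsto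
    have han : AnalyticAt ℂ g 0 := by
      refine Complex.analyticAt_of_differentiable_on_punctured_nhds_of_continuousAt ?_ hcont
      filter_upwards [eventually_notMem_lattice (periods τ), self_mem_nhdsWithin] with v hv hv0
      refine DifferentiableAt.congr_of_eventuallyEq ?_ (hgne v hv0)
      exact (differentiableAt_id.pow 1).mul (hA.differentiableAt v hv)
    have h1 : Tendsto (fun v => v * deriv g v) (𝓝[≠] 0) (𝓝 0) := by
      have := tendsto_id_nhdsNE_zero.mul
        (han.deriv.continuousAt.tendsto.mono_left (nhdsWithin_le_nhds (s := {0}ᶜ)))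
      simpa using this
    have h2 := hA.tendsto.sub h1
    rw [sub_zero] at h2
    refine h2.congr' ?_
    filter_upwards [eventually_notMem_lattice (periods τ), self_mem_nhdsWithin] with v hv hv0
    have h3 : HasDerivAt g (1 * A v + v * deriv A v) v := by
      refine HasDerivAt.congr_of_eventuallyEq ?_ (hgne v hv0)
      simpa using (hasDerivAt_id v).fun_mul (hA.differentiableAt v hv).hasDerivAt
    rw [h3.deriv]
    ring

lemma isSection_phi_zero (hχ : theta1 τ (chi τ α β) ≠ 0) : IsSection τ α β 1 1 (phi τ α β 0) := by
  rw [phi_zero_eq]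
  exact isSection_szegoProfile hχ

lemma isSection_phi_one (hχ : theta1 τ (chi τ α β) ≠ 0) : IsSection τ α β 2 1 (phi τ α β 1) := by
  rw [funext phi_one_eq]
  exact (isSection_szegoProfile hχ).neg_deriv

namespace IsSection

variable {n m : ℕ} {a b : ℂ} {A B : ℂ → ℂ}

lemma tendsto_mul_comp_neg (hA : IsSection τ α β n a A) (hB : IsSection τ α β m b B) :
    Tendsto (fun v => v ^ (n + m) * (A v * B (-v))) (𝓝[≠] 0) (𝓝 ((-1) ^ m * (a * b))) := by
  have h := (hA.tendsto.mul (hB.tendsto.comp tendsto_neg_nhdsNE_zero)).const_mul ((-1) ^ m)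
  refine h.congr fun v => ?_
  simp only [Function.comp_apply]
  rw [neg_pow v m]
  have : ((-1 : ℂ) ^ m) * (-1) ^ m = 1 := by rw [← mul_pow]; simp
  linear_combination (v ^ (n + m) * (A v * B (-v))) * this

/-- The reflection `v ↦ -v` inverts the multipliers of `B`, and they cancel those of `A`. -/
lemma mul_comp_neg (hA : IsSection τ α β n a A) (hB : IsSection τ α β m b B) :
    IsEllipticLE (periods τ) (n + m) (fun v => A v * B (-v)) := by
  refine .of_tendsto_pow_mul ?_ ?_ (hA.tendsto_mul_comp_neg hB)
  · refine periodic_of_add_one_of_add_tau τ (f := fun v => A v * B (-v)) (fun v => ?_) (fun v => ?_)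
    · rw [hA.add_one, show -v = -(v + 1) + 1 by ring, hB.add_one]
      ring
    · rw [hA.add_tau, show -v = -(v + τ) + τ by ring, hB.add_tau]
      ring
  · intro v hv
    exact (hA.differentiableAt v hv).mul
      ((hB.differentiableAt (-v) (notMem_neg hv)).comp v differentiableAt_id.neg)

end IsSection

/-- Exchanging `v` and `-v` swaps the columns, so the determinant is odd. It behaves like `2 / v³`
at `0` and `℘'` like `-2 / v³`; their sum is odd with at most a simple pole, hence zero. -/
lemma det_Phi (hχ : theta1 τ (chi τ α β) ≠ 0) {v : ℂ} (hv : v ∉ (periods τ).lattice) :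
    (Phi τ α β v).det = -(periods τ).derivWeierstrassP v := by
  have h0 := isSection_phi_zero hχ
  have h1 := isSection_phi_one hχ
  have hE : IsEllipticLE (periods τ) 3 (fun v => phi τ α β 0 v * phi τ α β 1 (-v) -
      phi τ α β 1 v * phi τ α β 0 (-v)) := (h0.mul_comp_neg h1).sub (h1.mul_comp_neg h0)
  have hT := (h0.tendsto_mul_comp_neg h1).sub (h1.tendsto_mul_comp_neg h0)
  have h2 := IsEllipticLE.of_tendsto hE (isEllipticLE_derivWeierstrassP (periods τ))
    (hT.congr fun v => by ring) (tendsto_cube_mul_derivWeierstrassP (periods τ)) (by norm_num)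
  norm_num at h2
  have hodd : ∀ v ∉ (periods τ).lattice, phi τ α β 0 (-v) * phi τ α β 1 v -
      phi τ α β 1 (-v) * phi τ α β 0 v - (periods τ).derivWeierstrassP v =
      -(phi τ α β 0 v * phi τ α β 1 (-v) - phi τ α β 1 v * phi τ α β 0 (-v) +
        (periods τ).derivWeierstrassP v) := fun v _ => by ring
  have h3 := IsEllipticLE.of_odd (n := 0) h2 (by simpa [← sub_eq_add_neg] using hodd)
  have h4 := IsEllipticLE.eq_zero_of_odd hχ h3 (by simpa [← sub_eq_add_neg] using hodd) v hv
  rw [Phi, Matrix.det_fin_two_of]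
  linear_combination h4

lemma det_Phi_ne_zero (hχ : theta1 τ (chi τ α β) ≠ 0) {v : ℂ} (hv : ¬ IsHalfPeriod τ v) :
    (Phi τ α β v).det ≠ 0 := by
  rw [det_Phi hχ (notMem_of_not_isHalfPeriod hv)]
  exact neg_ne_zero.2 (derivWeierstrassP_ne_zero hχ hv)

end szego

/-! ### Contour integrals, Taylor polynomials and divisibility -/

section contour
open Complex Polynomial Metric

variable {c : ℂ} {r ε : ℝ}

lemma sub_ne_zero_of_mem_sphere (hε : 0 < ε) {w : ℂ} (hw : w ∈ sphere c ε) : w - c ≠ 0 := by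
  rw [← norm_pos_iff, ← dist_eq_norm, mem_sphere.1 hw]
  exact hε

lemma circleIntegrable_of_continuousOn (hε : 0 < ε) {f : ℂ → ℂ} (hf : ContinuousOn f (sphere c ε)) :
    CircleIntegrable f c ε := hf.circleIntegrable hε.le

lemma continuousOn_eval_div_pow (hε : 0 < ε) (p : ℂ[X]) (n : ℕ) :
    ContinuousOn (fun w => p.eval w / (w - c) ^ n) (sphere c ε) :=
  p.continuous.continuousOn.div (by fun_prop)
    fun _ hw => pow_ne_zero _ (sub_ne_zero_of_mem_sphere hε hw)

/-- A rational function with a single pole at `c` that is `O(w⁻²)` at infinity has no residue. -/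
lemma circleIntegral_eval_div_pow (hε : 0 < ε) (d : ℕ) :
    ∀ (p : ℂ[X]) (n : ℕ), p.natDegree ≤ d → d + 2 ≤ n →
      ∮ w in C(c, ε), p.eval w / (w - c) ^ n = 0 := by
  have hzpow (a : ℂ) (n : ℕ) (hn : 2 ≤ n) : ∮ w in C(c, ε), a / (w - c) ^ n = 0 := by
    have h := circleIntegral.integral_sub_zpow_of_ne (n := -(n : ℤ)) (by omega) c c ε
    simp only [div_eq_mul_inv, circleIntegral.integral_const_mul]
    simp only [zpow_neg, zpow_natCast] at h
    rw [h, mul_zero]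
  induction d with
  | zero =>
    intro p n hp hn
    rw [Nat.le_zero, natDegree_eq_zero] at hp
    obtain ⟨a, rfl⟩ := hp
    simpa using hzpow a n hn
  | succ d ih =>
    intro p n hp hn
    -- Division of `p` by `X - c` lowers both the degree and the pole order by one, and leaves a
    -- constant over a power at least `2`.
    obtain ⟨n, rfl⟩ : ∃ k, n = k + 1 := ⟨n - 1, by omega⟩
    set k := p /ₘ (X - C c)
    have hk : k.natDegree ≤ d := by
      have : k.natDegree = p.natDegree - (X - C c).natDegree :=
        natDegree_divByMonic p (monic_X_sub_C c)
      rw [natDegree_X_sub_C] at this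
      omega
    have hdiv : C (p.eval c) + (X - C c) * k = p := by
      rw [← modByMonic_X_sub_C_eq_C_eval]
      exact modByMonic_add_div p (X - C c)
    have hsplit : Set.EqOn (fun w => p.eval w / (w - c) ^ (n + 1))
        (fun w => p.eval c / (w - c) ^ (n + 1) + k.eval w / (w - c) ^ n) (sphere c ε) := by
      intro w hw
      have h0 := sub_ne_zero_of_mem_sphere hε hw
      have he : p.eval w = p.eval c + (w - c) * k.eval w := by
        conv_lhs => rw [← hdiv]
        simp
      simp only [he, pow_succ]
      field_simp
    rw [circleIntegral.integral_congr hε.le hsplit, circleIntegral.integral_add, hzpow _ _ (by omega),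
      ih k n hk (by omega), add_zero]
    · have := continuousOn_eval_div_pow (c := c) hε (C (p.eval c)) (n + 1)
      simp only [eval_C] at this
      exact circleIntegrable_of_continuousOn hε this
    · exact circleIntegrable_of_continuousOn hε (continuousOn_eval_div_pow hε k n)

lemma sub_ne_zero_of_mem_sphere_of_lt {z : ℂ} (hz : ε < ‖z - c‖) {w : ℂ} (hw : w ∈ sphere c ε) :
    w - z ≠ 0 := by
  intro h
  rw [sub_eq_zero] at h
  rw [mem_sphere, dist_eq_norm, h] at hw
  exact hz.ne' hw

lemma circleIntegral_div_sub_of_lt (hε : 0 < ε) (hr : ε < r) {g : ℂ → ℂ}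
    (hg : DifferentiableOn ℂ g (ball c r)) {z : ℂ} (hz : ε < ‖z - c‖) :
    ∮ w in C(c, ε), g w / (w - z) = 0 := by
  have hsub : closedBall c ε ⊆ ball c r := closedBall_subset_ball hr
  have hne : ∀ w ∈ closedBall c ε, w - z ≠ 0 := by
    intro w hw h
    rw [sub_eq_zero] at h
    rw [mem_closedBall, dist_eq_norm, h] at hw
    exact absurd hz hw.not_gt
  refine Complex.circleIntegral_eq_zero_of_differentiable_on_off_countable hε.le
    Set.countable_empty ?_ ?_
  · exact (hg.continuousOn.mono hsub).div (by fun_prop) hne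
  · intro w hw
    have hw' := ball_subset_closedBall hw.1
    exact (hg.differentiableAt (isOpen_ball.mem_nhds (hsub hw'))).div (by fun_prop) (hne w hw')

/-- The partial fraction identity `(z - c) / ((w - c)(w - z)) = 1 / (w - z) - 1 / (w - c)` gives a
recursion in `n`; only the simple pole at `c` contributes. -/
lemma circleIntegral_inv_pow_mul_inv_sub (hε : 0 < ε) {z : ℂ} (hz : ε < ‖z - c‖) (n : ℕ) :
    ∮ w in C(c, ε), ((w - c) ^ (n + 1) * (w - z))⁻¹ = -(2 * π * I) / (z - c) ^ (n + 1) := by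
  have hzc : z - c ≠ 0 := norm_pos_iff.1 (hε.trans hz)
  have hcont (n : ℕ) : CircleIntegrable (fun w => ((w - c) ^ n * (w - z))⁻¹) c ε :=
    circleIntegrable_of_continuousOn hε (ContinuousOn.inv₀ (by fun_prop) fun w hw =>
      mul_ne_zero (pow_ne_zero _ (sub_ne_zero_of_mem_sphere hε hw))
        (sub_ne_zero_of_mem_sphere_of_lt hz hw))
  have hcont' (n : ℕ) : CircleIntegrable (fun w => ((w - c) ^ n)⁻¹) c ε :=
    circleIntegrable_of_continuousOn hε (ContinuousOn.inv₀ (by fun_prop) fun w hw =>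
      pow_ne_zero _ (sub_ne_zero_of_mem_sphere hε hw))
  have hsplit (n : ℕ) : ∮ w in C(c, ε), ((w - c) ^ (n + 1) * (w - z))⁻¹ =
      (z - c)⁻¹ * ((∮ w in C(c, ε), ((w - c) ^ n * (w - z))⁻¹) -
        ∮ w in C(c, ε), ((w - c) ^ (n + 1))⁻¹) := by
    rw [← circleIntegral.integral_sub (hcont n) (hcont' (n + 1)),
      ← circleIntegral.integral_const_mul]
    refine circleIntegral.integral_congr hε.le fun w hw => ?_
    have h1 := sub_ne_zero_of_mem_sphere hε hw
    have h2 := sub_ne_zero_of_mem_sphere_of_lt hz hw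
    simp only [pow_succ]
    field_simp
    ring
  induction n with
  | zero =>
    have h0 : ∮ w in C(c, ε), ((w - c) ^ 0 * (w - z))⁻¹ = 0 := by
      simpa using circleIntegral_div_sub_of_lt hε (lt_add_one ε) (g := fun _ => 1)
        (differentiableOn_const _) hz
    have h1 := circleIntegral.integral_sub_center_inv c hε.ne'
    rw [hsplit, h0]
    simp only [zero_add, pow_one, h1]
    field_simp
    ring
  | succ n ih =>
    have h1 : ∮ w in C(c, ε), ((w - c) ^ (n + 1 + 1))⁻¹ = 0 := by
      simpa using circleIntegral_eval_div_pow (c := c) hε 0 1 (n + 1 + 1) (by simp) (by omega)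
    rw [hsplit, ih, h1]
    field_simp
    ring

/-- Cauchy transform outside the circle of a function divided by a power: only the Taylor polynomial
contributes. -/
lemma circleIntegral_taylor (hε : 0 < ε) (hr : ε < r) {f g : ℂ → ℂ} {t : ℂ[X]} {n : ℕ}
    (ht : t.natDegree ≤ n) (hg : DifferentiableOn ℂ g (ball c r))
    (hf : ∀ w ∈ ball c r, f w = t.eval w + (w - c) ^ (n + 1) * g w) {z : ℂ} (hz : ε < ‖z - c‖) :
    ∮ w in C(c, ε), ((w - c) ^ (n + 1) * (w - z) * (2 * I * π))⁻¹ * f w =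
      -(t.eval z) / (z - c) ^ (n + 1) := by
  have hpi : (2 * I * π : ℂ) ≠ 0 := by
    simp
  set k := t /ₘ (X - C z)
  have hdiv : C (t.eval z) + (X - C z) * k = t := by
    rw [← modByMonic_X_sub_C_eq_C_eval]
    exact modByMonic_add_div t (X - C z)
  have hk : ∮ w in C(c, ε), k.eval w / (w - c) ^ (n + 1) = 0 := by
    have h : k.natDegree = t.natDegree - (X - C z).natDegree :=
      natDegree_divByMonic t (monic_X_sub_C z)
    rw [natDegree_X_sub_C] at h
    -- For `n = 0` the integrand need not be `O(w⁻²)` by degree alone, but then `t` is constant and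
    -- its quotient `k` is zero.
    rcases n with _ | n
    · have : k = 0 := by
        rw [divByMonic_eq_zero_iff (monic_X_sub_C z), degree_X_sub_C]
        exact (degree_le_of_natDegree_le ht).trans_lt (by norm_num)
      simp [this, circleIntegral]
    · exact circleIntegral_eval_div_pow hε n k _ (by omega) le_rfl
  have hsplit : Set.EqOn (fun w => ((w - c) ^ (n + 1) * (w - z) * (2 * I * π))⁻¹ * f w)
      (fun w => (2 * I * π)⁻¹ * (t.eval z * ((w - c) ^ (n + 1) * (w - z))⁻¹ +
        k.eval w / (w - c) ^ (n + 1) + g w / (w - z))) (sphere c ε) := by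
    intro w hw
    have h1 := sub_ne_zero_of_mem_sphere hε hw
    have h2 := sub_ne_zero_of_mem_sphere_of_lt hz hw
    have he : t.eval w = t.eval z + (w - z) * k.eval w := by
      conv_lhs => rw [← hdiv]
      simp
    simp only [hf w (sphere_subset_closedBall.trans (closedBall_subset_ball hr) hw), he]
    field_simp
  have hc1 : CircleIntegrable (fun w => t.eval z * ((w - c) ^ (n + 1) * (w - z))⁻¹) c ε :=
    circleIntegrable_of_continuousOn hε (continuousOn_const.mul
      (ContinuousOn.inv₀ (by fun_prop) fun w hw =>
        mul_ne_zero (pow_ne_zero _ (sub_ne_zero_of_mem_sphere hε hw))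
          (sub_ne_zero_of_mem_sphere_of_lt hz hw)))
  have hc2 := circleIntegrable_of_continuousOn hε (continuousOn_eval_div_pow (c := c) hε k (n + 1))
  have hc3 : CircleIntegrable (fun w => g w / (w - z)) c ε :=
    circleIntegrable_of_continuousOn hε ((hg.continuousOn.mono
      (sphere_subset_closedBall.trans (closedBall_subset_ball hr))).div (by fun_prop)
      fun w hw => sub_ne_zero_of_mem_sphere_of_lt hz hw)
  have hc12 : CircleIntegrable (fun w => t.eval z * ((w - c) ^ (n + 1) * (w - z))⁻¹ +
      k.eval w / (w - c) ^ (n + 1)) c ε := hc1.add hc2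
  rw [circleIntegral.integral_congr hε.le hsplit, circleIntegral.integral_const_mul,
    circleIntegral.integral_add hc12 hc3, circleIntegral.integral_add hc1 hc2,
    circleIntegral.integral_const_mul, circleIntegral_inv_pow_mul_inv_sub hε hz, hk,
    circleIntegral_div_sub_of_lt hε hr hg hz]
  field_simp
  ring

/-- Iteration of `f(w) = f(c) + (w - c) dslope f c w`: `dslope` stays holomorphic on the whole ball,
so the remainder does too. -/
lemma exists_taylor (hr : 0 < r) (n : ℕ) : ∀ {f : ℂ → ℂ}, DifferentiableOn ℂ f (ball c r) →
    ∃ (t : ℂ[X]) (g : ℂ → ℂ), t.natDegree ≤ n ∧ DifferentiableOn ℂ g (ball c r) ∧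
      ∀ w ∈ ball c r, f w = t.eval w + (w - c) ^ (n + 1) * g w := by
  have hb : ball c r ∈ 𝓝 c := ball_mem_nhds c hr
  have hslope (f : ℂ → ℂ) (w : ℂ) : f w = f c + (w - c) * dslope f c w := by
    have := sub_smul_dslope f c w
    rw [smul_eq_mul] at this
    linear_combination -this
  induction n with
  | zero =>
    intro f hf
    exact ⟨C (f c), dslope f c, by simp, (differentiableOn_dslope hb).2 hf,
      fun w _ => by simpa using hslope f w⟩
  | succ n ih =>
    intro f hf
    obtain ⟨t, g, ht, hg, h⟩ := ih ((differentiableOn_dslope hb).2 hf)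
    refine ⟨C (f c) + (X - C c) * t, g, ?_, hg, fun w hw => ?_⟩
    · refine natDegree_add_le_of_degree_le (by simp) (natDegree_mul_le.trans ?_)
      rw [natDegree_X_sub_C]
      omega
    · rw [hslope f w, h w hw]
      simp only [eval_add, eval_C, eval_mul, eval_sub, eval_X]
      ring

lemma pow_dvd_of_eventually_eq (n : ℕ) : ∀ {p : ℂ[X]} {g : ℂ → ℂ}, ContinuousAt g c →
    (∀ᶠ w in 𝓝[≠] c, p.eval w = (w - c) ^ n * g w) → (X - C c) ^ n ∣ p := by
  induction n with
  | zero => intro p g _ _; simp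
  | succ n ih =>
    intro p g hg h
    have h1 : Tendsto (fun w => p.eval w) (𝓝[≠] c) (𝓝 (p.eval c)) :=
      (p.continuous.tendsto c).mono_left nhdsWithin_le_nhds
    have h2 : Tendsto (fun w => (w - c) ^ (n + 1) * g w) (𝓝[≠] c) (𝓝 0) := by
      have : ContinuousAt (fun w => (w - c) ^ (n + 1) * g w) c := by fun_prop
      simpa using this.tendsto.mono_left (nhdsWithin_le_nhds (s := {c}ᶜ))
    have h0 : p.eval c = 0 := tendsto_nhds_unique h1 (h2.congr' (h.mono fun _ hw => hw.symm))
    obtain ⟨k, rfl⟩ := dvd_iff_isRoot.2 h0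
    rw [pow_succ']
    refine mul_dvd_mul_left _ (ih hg ?_)
    filter_upwards [h, self_mem_nhdsWithin] with w hw hwc
    have hwc : w - c ≠ 0 := sub_ne_zero.2 hwc
    simp only [eval_mul, eval_sub, eval_X, eval_C] at hw
    refine mul_left_cancel₀ hwc ?_
    rw [hw]
    ring

end contour

/-! ### Polynomial matrices with a spectral projector -/

section evalMat
open Polynomial

lemma evalMat_apply (P : Matrix (Fin 2) (Fin 2) ℂ[X]) (z : ℂ) (i j : Fin 2) :
    evalMat P z i j = (P i j).eval z := rfl

lemma evalMat_mul (P Q : Matrix (Fin 2) (Fin 2) ℂ[X]) (z : ℂ) :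
    evalMat (P * Q) z = evalMat P z * evalMat Q z :=
  Matrix.map_mul (f := evalRingHom z)

lemma evalMat_adjugate (P : Matrix (Fin 2) (Fin 2) ℂ[X]) (z : ℂ) :
    evalMat P.adjugate z = (evalMat P z).adjugate :=
  (evalRingHom z).map_adjugate P

lemma evalMat_det (P : Matrix (Fin 2) (Fin 2) ℂ[X]) (z : ℂ) :
    (evalMat P z).det = P.det.eval z :=
  ((evalRingHom z).map_det P).symm

end evalMat

lemma adjugate_eq_trace_smul_sub (A : Matrix (Fin 2) (Fin 2) ℂ) :
    A.adjugate = A.trace • 1 - A := by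
  ext i j
  rw [Matrix.adjugate_fin_two, Matrix.trace_fin_two]
  fin_cases i <;> fin_cases j <;> simp

section mop
open Complex Polynomial Metric

variable {c : ℂ} {r : ℝ} {R : ℕ} {N : Matrix (Fin 2) (Fin 2) ℂ[X]}
  {M : ℂ → Matrix (Fin 2) (Fin 2) ℂ} {y : ℂ → ℂ}

/-- Spectral data near `c` of a polynomial matrix `N` of degree at most `R` with determinant
`(X - c) ^ (2 R)`: the eigenvalue `y` does not vanish, and `M` is the projector onto its
eigenline. -/
structure IsSpectralData (c : ℂ) (r : ℝ) (R : ℕ) (N : Matrix (Fin 2) (Fin 2) ℂ[X])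
    (M : ℂ → Matrix (Fin 2) (Fin 2) ℂ) (y : ℂ → ℂ) : Prop where
  natDegree_le : ∀ i j, (N i j).natDegree ≤ R
  det_eq : N.det = (X - C c) ^ (2 * R)
  differentiableOn : ∀ i j, DifferentiableOn ℂ (fun w => M w i j) (ball c r)
  differentiableOn_eigenvalue : DifferentiableOn ℂ y (ball c r)
  eigenvalue_ne_zero : ∀ w ∈ ball c r, y w ≠ 0
  mul_self : ∀ w ∈ ball c r, M w * M w = M w
  trace_eq : ∀ w ∈ ball c r, (M w).trace = 1
  eq_add : ∀ w ∈ ball c r,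
    evalMat N w = y w • M w + ((w - c) ^ (2 * R) / y w) • (1 - M w)

namespace IsSpectralData

lemma mul_eq (h : IsSpectralData c r R N M y) {w : ℂ} (hw : w ∈ ball c r) :
    M w * evalMat N w = y w • M w := by
  rw [h.eq_add w hw, mul_add, Matrix.mul_smul, Matrix.mul_smul, mul_sub, mul_one, h.mul_self w hw,
    sub_self, smul_zero, add_zero]

/-- For a 2×2 matrix the adjugate is `trace - N`, so it exchanges the two eigenvalues. This is the
source of the vanishing to order `2R` at `c`. -/
lemma mul_adjugate_eq (h : IsSpectralData c r R N M y) {w : ℂ} (hw : w ∈ ball c r) :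
    M w * evalMat N.adjugate w = ((w - c) ^ (2 * R) / y w) • M w := by
  have ht : (evalMat N w).trace = y w + (w - c) ^ (2 * R) / y w := by
    rw [h.eq_add w hw, Matrix.trace_add, Matrix.trace_smul, Matrix.trace_smul, Matrix.trace_sub,
      h.trace_eq w hw, Matrix.trace_one, Fintype.card_fin, smul_eq_mul, smul_eq_mul]
    push_cast
    ring
  rw [evalMat_adjugate, adjugate_eq_trace_smul_sub, mul_sub, h.mul_eq hw, Matrix.mul_smul, mul_one,
    ht, ← sub_smul, add_sub_cancel_left]

lemma natDegree_adjugate_le (h : IsSpectralData c r R N M y) (i j : Fin 2) :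
    (N.adjugate i j).natDegree ≤ R := by
  rw [Matrix.adjugate_fin_two]
  fin_cases i <;> fin_cases j <;> simp [h.natDegree_le]

lemma eval_det (h : IsSpectralData c r R N M y) (z : ℂ) :
    (evalMat N z).det = (z - c) ^ (2 * R) := by
  rw [evalMat_det, h.det_eq]
  simp

/-- The Taylor polynomial of the projector, times the adjugate, is divisible by
`(X - c) ^ (2 R)`. -/
lemma exists_quotient (h : IsSpectralData c r R N M y) (hr : 0 < r) (hR : 0 < R) :
    ∃ (Q T : Matrix (Fin 2) (Fin 2) ℂ[X]) (G : ℂ → Matrix (Fin 2) (Fin 2) ℂ),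
      (∀ i j, (Q i j).natDegree ≤ R - 1) ∧ (∀ i j, (T i j).natDegree ≤ 2 * R - 1) ∧
      (∀ i j, DifferentiableOn ℂ (fun w => G w i j) (ball c r)) ∧
      (∀ w ∈ ball c r, M w = evalMat T w + (w - c) ^ (2 * R) • G w) ∧
      (∀ z, evalMat T z * evalMat N.adjugate z = (z - c) ^ (2 * R) • evalMat Q z) := by
  have hb : ball c r ∈ 𝓝 c := ball_mem_nhds c hr
  choose T g hT hg hTg using fun i j => exists_taylor hr (2 * R - 1) (h.differentiableOn i j)
  rw [show 2 * R - 1 + 1 = 2 * R by omega] at hTg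
  set T' : Matrix (Fin 2) (Fin 2) ℂ[X] := Matrix.of T
  set G : ℂ → Matrix (Fin 2) (Fin 2) ℂ := fun w => Matrix.of fun i j => g i j w
  have hMT (w) (hw : w ∈ ball c r) : M w = evalMat T' w + (w - c) ^ (2 * R) • G w := by
    ext i j
    exact hTg i j w hw
  -- Replacing `M` by its Taylor polynomial costs a multiple of `(w - c)^(2R)`, so the product still
  -- vanishes to that order.
  have hTN (w) (hw : w ∈ ball c r) : evalMat (T' * N.adjugate) w =
      (w - c) ^ (2 * R) • ((y w)⁻¹ • M w - G w * evalMat N.adjugate w) := by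
    have h1 := h.mul_adjugate_eq hw
    rw [evalMat_mul, smul_sub, smul_smul, ← div_eq_mul_inv, ← h1, ← Matrix.smul_mul, ← sub_mul]
    conv_rhs => rw [hMT w hw, add_sub_cancel_right]
  have hdvd (i j) : (X - C c) ^ (2 * R) ∣ (T' * N.adjugate) i j := by
    refine pow_dvd_of_eventually_eq (2 * R)
      (g := fun w => ((y w)⁻¹ • M w - G w * evalMat N.adjugate w) i j) ?_ ?_
    · have hy := (h.differentiableOn_eigenvalue.differentiableAt hb).continuousAt
      have hy0 := h.eigenvalue_ne_zero c (mem_ball_self hr)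
      have hM := ((h.differentiableOn i j).differentiableAt hb).continuousAt
      have hG (k) := ((hg i k).differentiableAt hb).continuousAt
      have hA (k) := (N.adjugate k j).continuous.continuousAt (x := c)
      have : (fun w => ((y w)⁻¹ • M w - G w * evalMat N.adjugate w) i j) = fun w =>
          (y w)⁻¹ * M w i j - (g i 0 w * (N.adjugate 0 j).eval w +
            g i 1 w * (N.adjugate 1 j).eval w) := by
        ext w
        rw [Matrix.sub_apply, Matrix.smul_apply, Matrix.mul_apply, Fin.sum_univ_two]
        rfl
      rw [this]
      exact ((hy.inv₀ hy0).mul hM).sub (((hG 0).mul (hA 0)).add ((hG 1).mul (hA 1)))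
    · filter_upwards [nhdsWithin_le_nhds hb] with w hw
      rw [← evalMat_apply, hTN w hw, Matrix.smul_apply, smul_eq_mul]
  choose Q hQ using hdvd
  refine ⟨Matrix.of Q, T', G, fun i j => ?_, hT, hg, hMT, fun z => ?_⟩
  -- Dividing by a monic polynomial of degree `2R` leaves degree at most `R - 1`.
  · have hdeg : ((T' * N.adjugate) i j).natDegree ≤ (2 * R - 1) + R := by
      rw [Matrix.mul_apply]
      refine natDegree_sum_le_of_forall_le _ _ fun k _ => natDegree_mul_le.trans ?_
      exact add_le_add (hT i k) (h.natDegree_adjugate_le k j)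
    rcases eq_or_ne (Q i j) 0 with h0 | h0
    · simp [h0]
    · have hmonic : ((X - C c) ^ (2 * R)).Monic := (monic_X_sub_C c).pow _
      rw [hQ, hmonic.natDegree_mul' h0, natDegree_pow, natDegree_X_sub_C] at hdeg
      rw [Matrix.of_apply]
      omega
  · rw [← evalMat_mul]
    ext i j
    rw [evalMat_apply, hQ, Matrix.smul_apply, evalMat_apply]
    simp

end IsSpectralData

/-- Splits the weight integrand into a part holomorphic on the whole ball and the rational part `-N
/ (w - c)^(2R)`. It follows from `Q N = T` and `M N = y M = N - ((w - c)^(2R) / y)(1 - M)`. -/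
lemma IsSpectralData.integrand_eqOn (h : IsSpectralData c r R N M y)
    {Q T : Matrix (Fin 2) (Fin 2) ℂ[X]} {G : ℂ → Matrix (Fin 2) (Fin 2) ℂ}
    (hMT : ∀ w ∈ ball c r, M w = evalMat T w + (w - c) ^ (2 * R) • G w)
    (hQ : ∀ z, evalMat T z * evalMat N.adjugate z = (z - c) ^ (2 * R) • evalMat Q z)
    {w : ℂ} (hw : w ∈ ball c r) (hwc : w - c ≠ 0) :
    evalMat (-Q) w * (((w - c) ^ R)⁻¹ • evalMat N w) ^ 2 =
      ((y w)⁻¹ • (1 - M w) + G w * evalMat N w) - ((w - c) ^ (2 * R))⁻¹ • evalMat N w := by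
  have hD : (w - c) ^ (2 * R) ≠ 0 := pow_ne_zero _ hwc
  have hQN : evalMat Q w * evalMat N w = evalMat T w := by
    have h1 : (w - c) ^ (2 * R) • (evalMat Q w * evalMat N w) =
        (w - c) ^ (2 * R) • evalMat T w := by
      rw [← Matrix.smul_mul, ← hQ, evalMat_adjugate, mul_assoc, Matrix.adjugate_mul, h.eval_det,
        Matrix.mul_smul, mul_one]
    exact smul_right_injective _ hD h1
  have hneg : evalMat (-Q) w = -evalMat Q w := by
    ext i j
    simp [evalMat_apply]
  have hTN : evalMat T w * evalMat N w =
      evalMat N w - (w - c) ^ (2 * R) • ((y w)⁻¹ • (1 - M w) + G w * evalMat N w) := by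
    have h1 := h.mul_eq hw
    have h2 := h.eq_add w hw
    have h3 : evalMat T w = M w - (w - c) ^ (2 * R) • G w := by
      rw [hMT w hw, add_sub_cancel_right]
    rw [h3, sub_mul, h1, Matrix.smul_mul, smul_add, smul_smul, ← div_eq_mul_inv, ← sub_sub]
    congr 1
    exact eq_sub_of_add_eq h2.symm
  rw [_root_.smul_pow, Matrix.mul_smul, hneg, neg_mul, sq (evalMat N w), ← mul_assoc, hQN, hTN, ← inv_pow,
    ← pow_mul, mul_comm R 2, inv_pow, neg_sub, smul_sub, smul_smul, inv_mul_cancel₀ hD, one_smul]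

/-- The matrix of polynomials attached to a polynomial matrix `N` with spectral projector `M`:
Cauchy transform formula and orthogonality. -/
theorem IsSpectralData.exists_orthogonal (h : IsSpectralData c r R N M y) (hr : 0 < r)
    (hR : 0 < R) :
    ∃ P : Matrix (Fin 2) (Fin 2) ℂ[X], (∀ i j, (P i j).natDegree ≤ R - 1) ∧
      ∀ ε : ℝ, 0 < ε → ε < r →
        (∀ z : ℂ, ε < ‖z - c‖ → evalMat P z = (z - c) ^ R •
          (matCircleIntegral (fun w => ((w - c) ^ (2 * R) * (w - z) * (2 * I * π))⁻¹ • M w) c ε *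
            (((z - c) ^ R)⁻¹ • evalMat N z)⁻¹)) ∧
        ∀ ℓ : ℕ, ℓ + 2 ≤ R →
          (∀ i j, CircleIntegrable (fun z =>
            (z ^ ℓ • (evalMat P z * (((z - c) ^ R)⁻¹ • evalMat N z) ^ 2)) i j) c ε) ∧
          matCircleIntegral (fun z =>
            z ^ ℓ • (evalMat P z * (((z - c) ^ R)⁻¹ • evalMat N z) ^ 2)) c ε = 0 := by
  obtain ⟨Q, T, G, hQdeg, hTdeg, hG, hMT, hQ⟩ := h.exists_quotient hr hR
  -- The sign comes from the Cauchy kernel `1 / (w - z)` with `z` outside the circle.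
  refine ⟨-Q, fun i j => by simpa using hQdeg i j, fun ε hε hεr => ⟨fun z hz => ?_, fun ℓ hℓ => ?_⟩⟩
  · have hzc : z - c ≠ 0 := norm_pos_iff.1 (hε.trans hz)
    have hD : (z - c) ^ R ≠ 0 := pow_ne_zero _ hzc
    have hint : matCircleIntegral
        (fun w => ((w - c) ^ (2 * R) * (w - z) * (2 * I * π))⁻¹ • M w) c ε =
        -((z - c) ^ (2 * R))⁻¹ • evalMat T z := by
      ext i j
      have := circleIntegral_taylor hε hεr (hTdeg i j) (hG i j) (f := fun w => M w i j)
        (fun w hw => by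
          rw [hMT w hw, show 2 * R - 1 + 1 = 2 * R by omega]
          rfl) hz
      rw [show 2 * R - 1 + 1 = 2 * R by omega] at this
      refine this.trans ?_
      rw [Matrix.smul_apply, evalMat_apply, smul_eq_mul, div_eq_inv_mul]
      ring
    have hinv : (((z - c) ^ R)⁻¹ • evalMat N z)⁻¹ =
        ((z - c) ^ R)⁻¹ • evalMat N.adjugate z := by
      refine Matrix.inv_eq_right_inv ?_
      rw [Matrix.smul_mul, Matrix.mul_smul, evalMat_adjugate, Matrix.mul_adjugate, h.eval_det,
        smul_smul, smul_smul, two_mul, pow_add]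
      rw [show ((z - c) ^ R)⁻¹ * ((z - c) ^ R)⁻¹ * ((z - c) ^ R * (z - c) ^ R) = 1 by
        field_simp, one_smul]
    rw [hint, hinv, Matrix.smul_mul, Matrix.mul_smul, hQ, smul_smul, smul_smul, smul_smul]
    rw [show (z - c) ^ R * -((z - c) ^ (2 * R))⁻¹ * ((z - c) ^ R)⁻¹ * (z - c) ^ (2 * R) = -1 by
      field_simp]
    ext i j
    simp [evalMat_apply]
  · have hsub : sphere c ε ⊆ ball c r :=
      sphere_subset_closedBall.trans (closedBall_subset_ball hεr)
    have hhol (i j) : DifferentiableOn ℂ (fun w => w ^ ℓ *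
        ((y w)⁻¹ • (1 - M w) + G w * evalMat N w) i j) (ball c r) := by
      have hN (k) : Differentiable ℂ fun w => (N k j).eval w := (N k j).differentiable
      have : (fun w => w ^ ℓ * ((y w)⁻¹ • (1 - M w) + G w * evalMat N w) i j) = fun w =>
          w ^ ℓ * ((y w)⁻¹ * ((1 : Matrix (Fin 2) (Fin 2) ℂ) i j - M w i j) +
            (G w i 0 * (N 0 j).eval w + G w i 1 * (N 1 j).eval w)) := by
        ext w
        rw [Matrix.add_apply, Matrix.smul_apply, Matrix.mul_apply, Fin.sum_univ_two]
        rfl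
      rw [this]
      exact (differentiableOn_id.pow ℓ).mul
        (((h.differentiableOn_eigenvalue.inv h.eigenvalue_ne_zero).mul
          ((h.differentiableOn i j).const_sub _)).add
          (((hG i 0).mul (hN 0).differentiableOn).add ((hG i 1).mul (hN 1).differentiableOn)))
    have hEq (i j) : Set.EqOn
        (fun w => (w ^ ℓ • (evalMat (-Q) w * (((w - c) ^ R)⁻¹ • evalMat N w) ^ 2)) i j)
        (fun w => w ^ ℓ * ((y w)⁻¹ • (1 - M w) + G w * evalMat N w) i j -
          (X ^ ℓ * N i j).eval w / (w - c) ^ (2 * R)) (sphere c ε) := by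
      intro w hw
      have := h.integrand_eqOn hMT hQ (hsub hw) (sub_ne_zero_of_mem_sphere hε hw)
      simp only [this]
      rw [Matrix.smul_apply, Matrix.sub_apply, Matrix.smul_apply, evalMat_apply, smul_eq_mul,
        smul_eq_mul, eval_mul, eval_pow, eval_X]
      ring
    have hc1 (i j) := (hhol i j).continuousOn.mono hsub
    have hc2 (i j) := continuousOn_eval_div_pow (c := c) hε (X ^ ℓ * N i j) (2 * R)
    refine ⟨fun i j => circleIntegrable_of_continuousOn hε
      (((hc1 i j).sub (hc2 i j)).congr (hEq i j)), ?_⟩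
    ext i j
    refine (circleIntegral.integral_congr hε.le (hEq i j)).trans ?_
    rw [circleIntegral.integral_sub (circleIntegrable_of_continuousOn hε (hc1 i j))
      (circleIntegrable_of_continuousOn hε (hc2 i j)),
      -- The numerator has degree at most `ℓ + R`, and `ℓ + R + 2 ≤ 2R` is exactly the range of `ℓ`
      -- allowed.
      circleIntegral_eval_div_pow hε (ℓ + R) _ _ ?_ (by omega), sub_zero]
    · have hcl : closedBall c ε ⊆ ball c r := closedBall_subset_ball hεr
      exact Complex.circleIntegral_eq_zero_of_differentiable_on_off_countable hε.le
        Set.countable_empty ((hhol i j).continuousOn.mono hcl) fun w hw =>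
          (hhol i j).differentiableAt (isOpen_ball.mem_nhds (hcl (ball_subset_closedBall hw.1)))
    · refine natDegree_mul_le.trans (add_le_add ?_ (h.natDegree_le i j))
      rw [natDegree_X_pow]

end mop

/-! ### The eigenvalue `(℘ - z⋆)^R Y` -/

section eigenvalue
open Complex

/-- The function `(℘(v) - z⋆) ^ R * Y(v)`, written without removable singularities. -/
noncomputable def clearedY (τ : ℍ) (R : ℕ) (a b : ℤ) (s : ℤˣ) (v : ℂ) : ℂ :=
  ((s : ℤ) : ℂ) *
    (-(deriv (theta1 τ) 0 / theta1 τ (torsionPt τ R a b)) ^ 2 *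
      (exp (2 * I * π * (a / R) * v) *
        (theta1 τ (v + torsionPt τ R a b) ^ 2 / theta1 τ v ^ 2))) ^ R

variable {τ : ℍ} {R : ℕ} {a b : ℤ} {s : ℤˣ} {u : ℂ}

lemma wp_sub_zStar (hu : theta1 τ u ≠ 0) (hq : ¬ IsHalfPeriod τ (torsionPt τ R a b)) {v : ℂ}
    (hv : v ∉ (periods τ).lattice) :
    wp τ v - zStar τ R a b = -(deriv (theta1 τ) 0 / theta1 τ (torsionPt τ R a b)) ^ 2 *
      (theta1 τ (v + torsionPt τ R a b) * theta1 τ (v - torsionPt τ R a b) / theta1 τ v ^ 2) := by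
  have hq' := notMem_of_not_isHalfPeriod hq
  have h0 := (theta1_eq_zero_iff hu).not.2 hq'
  have h1 := deriv_theta1_zero_ne_zero hu
  rw [theta1_mul_theta1_div_sq hu hv hq', zStar]
  field_simp

lemma clearedY_eq (hu : theta1 τ u ≠ 0) (hq : ¬ IsHalfPeriod τ (torsionPt τ R a b)) {v : ℂ}
    (hv : v ∉ (periods τ).lattice) (hvq : wp τ v ≠ zStar τ R a b) :
    clearedY τ R a b s v = (wp τ v - zStar τ R a b) ^ R * Y τ R a b s v := by
  have h1 := wp_sub_zStar hu hq hv
  have h2 : theta1 τ (v - torsionPt τ R a b) ≠ 0 := by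
    intro h
    rw [h, mul_zero, zero_div, mul_zero, sub_eq_zero] at h1
    exact hvq h1
  rw [Y, clearedY, mul_left_comm (_ ^ R), ← mul_pow, h1]
  congr 2
  field_simp

/-- Reflects `Y(v) Y(-v) = 1`. In the cleared form it also holds over `z⋆`, where `Y` has its zero
and pole. -/
lemma clearedY_mul_neg (hu : theta1 τ u ≠ 0) (hq : ¬ IsHalfPeriod τ (torsionPt τ R a b)) {v : ℂ}
    (hv : v ∉ (periods τ).lattice) :
    clearedY τ R a b s v * clearedY τ R a b s (-v) = (wp τ v - zStar τ R a b) ^ (2 * R) := by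
  have hs : ((s : ℤ) : ℂ) * ((s : ℤ) : ℂ) = 1 := by
    rcases Int.units_eq_one_or s with h | h <;> simp [h]
  have he : exp (2 * I * π * (a / R) * v) * exp (2 * I * π * (a / R) * -v) = 1 := by
    rw [← exp_add, mul_neg, add_neg_cancel, exp_zero]
  rw [wp_sub_zStar hu hq hv, pow_mul, clearedY, clearedY, mul_mul_mul_comm, hs, one_mul, ← mul_pow]
  congr 1
  rw [show -v + torsionPt τ R a b = -(v - torsionPt τ R a b) by ring, theta1_neg, theta1_neg,
    neg_sq, neg_sq]
  generalize exp (2 * I * π * (a / R) * v) = e1 at *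
  generalize exp (2 * I * π * (a / R) * -v) = e2 at *
  simp only [div_eq_mul_inv]
  linear_combination ((deriv (theta1 τ) 0 * (theta1 τ (torsionPt τ R a b))⁻¹) ^ 4 *
    theta1 τ (v + torsionPt τ R a b) ^ 2 * theta1 τ (v - torsionPt τ R a b) ^ 2 *
      ((theta1 τ v ^ 2)⁻¹) ^ 2) * he

/-- The base of the `R`-th power is multiplied by `e^(2πia/R)` under `v + 1` and by `e^(2πi(aτ/R -
2q))` under `v + τ`. Both are `R`-th roots of unity, the second because `2Rq = b + aτ`. -/
lemma isEllipticLE_clearedY (hu : theta1 τ u ≠ 0) (hR : 0 < R) :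
    IsEllipticLE (periods τ) (2 * R) (clearedY τ R a b s) := by
  have hR' : (R : ℂ) ≠ 0 := Nat.cast_ne_zero.2 hR.ne'
  set q := torsionPt τ R a b with hq
  have hd := differentiable_theta1 τ
  have h1 := tendsto_id_div_theta1 hu
  have hc : Continuous fun v => exp (2 * I * π * (a / R) * v) * theta1 τ (v + q) ^ 2 := by
    have := hd.continuous
    fun_prop
  have h2 := (((hc.tendsto 0).mono_left (nhdsWithin_le_nhds (s := {0}ᶜ))).mul (h1.pow 2))
  have h3 := ((h2.const_mul (-(deriv (theta1 τ) 0 / theta1 τ q) ^ 2)).pow R).const_mul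
    ((s : ℤ) : ℂ)
  refine .of_tendsto_pow_mul ?_ ?_ (h3.congr fun v => ?_)
  · refine periodic_of_add_one_of_add_tau τ (fun v => ?_) (fun v => ?_)
    · rw [clearedY, clearedY, ← hq, show v + 1 + q = v + q + 1 by ring, theta1_add_one,
        theta1_add_one, neg_sq, neg_sq,
        show 2 * I * π * (a / R) * (v + 1) = 2 * I * π * (a / R) + 2 * I * π * (a / R) * v by ring,
        exp_add]
      have h : exp (2 * I * π * (a / R)) ^ R = 1 := by
        rw [← exp_nat_mul, exp_eq_one_iff]
        exact ⟨a, by field_simp⟩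
      simp only [mul_pow, h, one_mul]
    · rw [clearedY, clearedY, ← hq, show v + τ + q = v + q + τ by ring, theta1_add_tau,
        theta1_add_tau]
      have h : exp (2 * I * π * (a / R) * (v + τ)) *
          (exp (-(I * π * τ) - 2 * π * I * (v + q)) ^ 2 *
            (exp (-(I * π * τ) - 2 * π * I * v) ^ 2)⁻¹) =
          exp (2 * I * π * (a / R) * v) * exp (2 * I * π * (a / R) * τ - 4 * π * I * q) := by
        rw [← exp_nat_mul, ← exp_nat_mul, ← exp_neg, ← exp_add, ← exp_add, ← exp_add]
        congr 1
        push_cast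
        ring
      have h' : exp (2 * I * π * (a / R) * τ - 4 * π * I * q) ^ R = 1 := by
        rw [← exp_nat_mul, exp_eq_one_iff]
        refine ⟨-b, ?_⟩
        rw [hq, torsionPt]
        push_cast
        field_simp
        ring
      have h'' : exp (2 * I * π * (a / R) * (v + τ)) *
          ((-exp (-(I * π * τ) - 2 * π * I * (v + q)) * theta1 τ (v + q)) ^ 2 /
            (-exp (-(I * π * τ) - 2 * π * I * v) * theta1 τ v) ^ 2) =
          exp (2 * I * π * (a / R) * τ - 4 * π * I * q) *
            (exp (2 * I * π * (a / R) * v) * (theta1 τ (v + q) ^ 2 / theta1 τ v ^ 2)) := by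
        simp only [div_eq_mul_inv, mul_pow, neg_sq, mul_inv] at h ⊢
        linear_combination (theta1 τ (v + q) ^ 2 * (theta1 τ v ^ 2)⁻¹) * h
      rw [h'', mul_left_comm, mul_pow (exp _), h', one_mul]
  · intro v hv
    have h0 : theta1 τ v ^ 2 ≠ 0 := pow_ne_zero 2 ((theta1_eq_zero_iff hu).not.2 hv)
    have : DifferentiableAt ℂ (fun v => theta1 τ (v + q) ^ 2 / theta1 τ v ^ 2) v :=
      DifferentiableAt.fun_div (by fun_prop) (by fun_prop) h0
    unfold clearedY
    fun_prop
  · rw [clearedY, mul_left_comm (v ^ _), pow_mul, ← mul_pow]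
    congr 2
    rw [div_pow]
    ring

end eigenvalue

/-! ### Polynomiality of `(z - z⋆)^R √W` -/

section weight
open Polynomial

variable {τ : ℍ} {α β : ℝ} {R : ℕ} {a b : ℤ} {s : ℤˣ}

/-- The matrix `(z - z⋆) ^ R * √W(z)` is a polynomial of degree at most `R` in `z = ℘(v)`. -/
theorem exists_polynomial_weight (hχ : theta1 τ (chi τ α β) ≠ 0) (hR : 0 < R) :
    ∃ N : Matrix (Fin 2) (Fin 2) ℂ[X], (∀ i j, (N i j).natDegree ≤ R) ∧
      ∀ v, ¬ IsHalfPeriod τ v → evalMat N (wp τ v) = Phi τ α β v *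
        Matrix.diagonal ![clearedY τ R a b s v, clearedY τ R a b s (-v)] * (Phi τ α β v)⁻¹ := by
  have h0 := isSection_phi_zero hχ
  have h1 := isSection_phi_one hχ
  have hy : IsEllipticLE (periods τ) (2 * R) (clearedY τ R a b s) := isEllipticLE_clearedY hχ hR
  set H : ℂ → Matrix (Fin 2) (Fin 2) ℂ := fun v => Phi τ α β v *
    Matrix.diagonal ![clearedY τ R a b s v, clearedY τ R a b s (-v)] * (Phi τ α β v).adjugate
    with hH
  have hHv (v : ℂ) : H v =
      !![clearedY τ R a b s v * (phi τ α β 0 v * phi τ α β 1 (-v)) -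
          clearedY τ R a b s (-v) * (phi τ α β 1 v * phi τ α β 0 (-v)),
        clearedY τ R a b s (-v) * (phi τ α β 0 v * phi τ α β 0 (-v)) -
          clearedY τ R a b s v * (phi τ α β 0 v * phi τ α β 0 (-v));
        clearedY τ R a b s v * (phi τ α β 1 v * phi τ α β 1 (-v)) -
          clearedY τ R a b s (-v) * (phi τ α β 1 v * phi τ α β 1 (-v)),
        clearedY τ R a b s (-v) * (phi τ α β 0 v * phi τ α β 1 (-v)) -
          clearedY τ R a b s v * (phi τ α β 1 v * phi τ α β 0 (-v))] := by
    ext i j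
    simp only [hH, Phi, Matrix.adjugate_fin_two, Matrix.mul_apply, Fin.sum_univ_two]
    fin_cases i <;> fin_cases j <;> simp [Matrix.diagonal] <;> ring
  -- Reflection swaps the columns of `Φ` together with the diagonal entries; only the determinant
  -- hidden in the adjugate changes sign.
  have hodd (i j) (v : ℂ) (_ : v ∉ (periods τ).lattice) : H (-v) i j = -H v i j := by
    rw [hHv, hHv]
    fin_cases i <;> fin_cases j <;> simp <;> ring
  have e00 := (h0.mul_comp_neg h0).mono (show 1 + 1 ≤ 3 by norm_num)
  have e01 := h0.mul_comp_neg h1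
  have e10 := h1.mul_comp_neg h0
  have hell (i j) : IsEllipticLE (periods τ) (2 * R + 3) (fun v => H v i j) := by
    simp only [hHv]
    fin_cases i <;> fin_cases j <;> simp
    · exact (hy.mul e01).sub (hy.comp_neg.mul e10)
    · exact (hy.comp_neg.mul e00).sub (hy.mul e00)
    -- A termwise bound gives pole order `2R + 4`, one too many. The difference of the two
    -- eigenvalues is odd, so its pole has order at most `2R - 1`.
    · have hd : IsEllipticLE (periods τ) (2 * (R - 1) + 1)
          (fun v => clearedY τ R a b s v - clearedY τ R a b s (-v)) := by
        refine IsEllipticLE.of_odd ?_ fun v _ => by rw [neg_neg]; ring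
        rw [show 2 * (R - 1) + 2 = 2 * R by omega]
        exact hy.sub hy.comp_neg
      have := hd.mul (h1.mul_comp_neg h1)
      rw [show 2 * (R - 1) + 1 + (2 + 2) = 2 * R + 3 by omega] at this
      simpa only [sub_mul] using this
    · exact (hy.comp_neg.mul e01).sub (hy.mul e10)
  choose N hN hNH using fun i j => (hell i j).exists_polynomial_of_odd hχ R (hodd i j)
  refine ⟨-Matrix.of N, fun i j => by simpa using hN i j, fun v hv => ?_⟩
  have hv' := notMem_of_not_isHalfPeriod hv
  have hdet := det_Phi hχ hv'
  have hp := derivWeierstrassP_ne_zero hχ hv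
  have hHN : H v = -(periods τ).derivWeierstrassP v • evalMat (-Matrix.of N) (wp τ v) := by
    ext i j
    rw [hNH i j v hv', Matrix.smul_apply, evalMat_apply, Matrix.neg_apply, eval_neg, smul_eq_mul,
      neg_mul_neg, Matrix.of_apply]
  rw [Matrix.inv_def, hdet, Matrix.mul_smul, Ring.inverse_eq_inv']
  change _ = (-(periods τ).derivWeierstrassP v)⁻¹ • H v
  rw [hHN, smul_smul, inv_mul_cancel₀ (neg_ne_zero.2 hp), one_smul]

end weight

/-! ### The main sheet, its projector and the spectral data -/

section sheet
open Metric

variable {τ : ℍ} {u : ℂ}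

/-- A local inverse of `℘` at a point that is neither a period nor a half-period. -/
lemma exists_local_inverse_wp (hu : theta1 τ u ≠ 0) {q : ℂ} (hq : ¬ IsHalfPeriod τ q) :
    ∃ (r : ℝ) (ν : ℂ → ℂ), 0 < r ∧ DifferentiableOn ℂ ν (ball (wp τ q) r) ∧ ν (wp τ q) = q ∧
      ∀ z ∈ ball (wp τ q) r, wp τ (ν z) = z ∧ ¬ IsHalfPeriod τ (ν z) := by
  have hq' := notMem_of_not_isHalfPeriod hq
  have han : AnalyticAt ℂ (wp τ) q := (periods τ).analyticOnNhd_weierstrassP q hq'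
  have hd : deriv (wp τ) q ≠ 0 := by
    rw [(hasDerivAt_wp hq').deriv]
    exact derivWeierstrassP_ne_zero hu hq
  have hs := han.hasStrictDerivAt
  set ν := hs.localInverse _ _ _ hd
  have h1 : ν (wp τ q) = q := (hs.hasStrictFDerivAt_equiv hd).localInverse_apply_image
  have h2 : ∀ᶠ z in 𝓝 (wp τ q), wp τ (ν z) = z :=
    (hs.hasStrictFDerivAt_equiv hd).eventually_right_inverse
  have hcont : ContinuousAt ν (wp τ q) := (hs.to_localInverse hd).hasDerivAt.continuousAt
  have hopen : IsOpen {v : ℂ | ¬ IsHalfPeriod τ v} := by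
    have : {v : ℂ | ¬ IsHalfPeriod τ v} = (fun v => 2 * v) ⁻¹' ((periods τ).lattice : Set ℂ)ᶜ := by
      ext v
      simp [isHalfPeriod_iff]
    rw [this]
    exact (periods τ).isClosed_lattice.isOpen_compl.preimage (by fun_prop)
  have h3 : ∀ᶠ z in 𝓝 (wp τ q), ¬ IsHalfPeriod τ (ν z) :=
    hcont.eventually (hopen.mem_nhds (by rw [h1]; exact hq))
  have h4 : ∀ᶠ z in 𝓝 (wp τ q), DifferentiableAt ℂ ν z :=
    (han.analyticAt_localInverse hd).eventually_analyticAt.mono fun _ h => h.differentiableAt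
  obtain ⟨r, hr, h⟩ := eventually_nhds_iff_ball.1 (h2.and (h3.and h4))
  exact ⟨r, ν, hr, fun z hz => (h z hz).2.2.differentiableWithinAt, h1,
    fun z hz => ⟨(h z hz).1, (h z hz).2.1⟩⟩

end sheet

section sheetProj
open Complex Polynomial Metric

variable {τ : ℍ} {α β : ℝ} {R : ℕ} {a b : ℤ} {s : ℤˣ}

lemma sheetProj_apply (v : ℂ) (i j : Fin 2) :
    sheetProj τ α β v i j = Phi τ α β v i 0 *
      (((Phi τ α β v).det)⁻¹ * (Phi τ α β v).adjugate 0 j) := by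
  rw [sheetProj, Matrix.mul_apply, Fin.sum_univ_two, Matrix.mul_apply, Matrix.mul_apply,
    Matrix.inv_def, Ring.inverse_eq_inv']
  simp [Matrix.single]

lemma differentiableAt_sheetProj (hχ : theta1 τ (chi τ α β) ≠ 0) {v : ℂ}
    (hv : ¬ IsHalfPeriod τ v) (i j : Fin 2) :
    DifferentiableAt ℂ (fun v => sheetProj τ α β v i j) v := by
  have hv' := notMem_of_not_isHalfPeriod hv
  have hphi (i j) : DifferentiableAt ℂ (fun v => Phi τ α β v i j) v := by
    have h0 := (isSection_phi_zero hχ).differentiableAt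
    have h1 := (isSection_phi_one hχ).differentiableAt
    fin_cases i <;> fin_cases j
    · exact h0 v hv'
    · exact (h0 _ (notMem_neg hv')).comp v differentiableAt_id.neg
    · exact h1 v hv'
    · exact (h1 _ (notMem_neg hv')).comp v differentiableAt_id.neg
  have hadj (j) : DifferentiableAt ℂ (fun v => (Phi τ α β v).adjugate 0 j) v := by
    simp only [Matrix.adjugate_fin_two]
    fin_cases j
    · exact hphi 1 1
    · exact (hphi 0 1).neg
  have hdet : DifferentiableAt ℂ (fun v => (Phi τ α β v).det) v := by
    simp only [Matrix.det_fin_two]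
    exact ((hphi 0 0).mul (hphi 1 1)).sub ((hphi 0 1).mul (hphi 1 0))
  simp only [sheetProj_apply]
  exact (hphi i 0).mul ((hdet.inv (det_Phi_ne_zero hχ hv)).mul (hadj j))

lemma isUnit_det_Phi (hχ : theta1 τ (chi τ α β) ≠ 0) {v : ℂ} (hv : ¬ IsHalfPeriod τ v) :
    IsUnit (Phi τ α β v).det := isUnit_iff_ne_zero.2 (det_Phi_ne_zero hχ hv)

lemma sheetProj_mul_self (hχ : theta1 τ (chi τ α β) ≠ 0) {v : ℂ} (hv : ¬ IsHalfPeriod τ v) :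
    sheetProj τ α β v * sheetProj τ α β v = sheetProj τ α β v := by
  have h := Matrix.nonsing_inv_mul _ (isUnit_det_Phi hχ hv)
  calc _ = Phi τ α β v * Matrix.single 0 0 1 * ((Phi τ α β v)⁻¹ * Phi τ α β v) *
        (Matrix.single 0 0 1 * (Phi τ α β v)⁻¹) := by simp only [sheetProj, mul_assoc]
    _ = _ := by
      rw [h, mul_one, ← mul_assoc, mul_assoc (Phi τ α β v), Matrix.single_mul_single_same, mul_one,
        sheetProj]

lemma trace_sheetProj (hχ : theta1 τ (chi τ α β) ≠ 0) {v : ℂ} (hv : ¬ IsHalfPeriod τ v) :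
    (sheetProj τ α β v).trace = 1 := by
  rw [sheetProj, mul_assoc, Matrix.trace_mul_comm, mul_assoc,
    Matrix.nonsing_inv_mul _ (isUnit_det_Phi hχ hv), mul_one, Matrix.trace_fin_two]
  simp

lemma Phi_mul_diagonal_mul_inv (hχ : theta1 τ (chi τ α β) ≠ 0) {v : ℂ} (hv : ¬ IsHalfPeriod τ v)
    (x y : ℂ) : Phi τ α β v * Matrix.diagonal ![x, y] * (Phi τ α β v)⁻¹ =
      x • sheetProj τ α β v + y • (1 - sheetProj τ α β v) := by
  have h : Matrix.diagonal ![x, y] = x • Matrix.single (0 : Fin 2) (0 : Fin 2) (1 : ℂ) +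
      y • (1 - Matrix.single 0 0 1) := by
    ext i j
    fin_cases i <;> fin_cases j <;> simp
  rw [h, mul_add, add_mul, Matrix.mul_smul, Matrix.smul_mul, Matrix.mul_smul, Matrix.smul_mul,
    mul_sub, sub_mul, mul_one, Matrix.mul_nonsing_inv _ (isUnit_det_Phi hχ hv), sheetProj]

/-- Away from `z⋆` the product over the two sheets is nonzero. Over `z⋆` the sheet matters: at `q`
the factor is `θ₁(2q) ≠ 0`, whereas at `-q` the function vanishes. -/
lemma clearedY_ne_zero (hu : theta1 τ (chi τ α β) ≠ 0)
    (hq : ¬ IsHalfPeriod τ (torsionPt τ R a b)) {v : ℂ}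
    (hv : v ∉ (periods τ).lattice)
    (h : wp τ v = zStar τ R a b → v = torsionPt τ R a b) : clearedY τ R a b s v ≠ 0 := by
  by_cases hz : wp τ v = zStar τ R a b
  · have h2 : theta1 τ (torsionPt τ R a b + torsionPt τ R a b) ≠ 0 := by
      rw [ne_eq, theta1_eq_zero_iff hu, ← two_mul, ← isHalfPeriod_iff]
      exact hq
    have h1 := (theta1_eq_zero_iff hu).not.2 (notMem_of_not_isHalfPeriod hq)
    have h3 := deriv_theta1_zero_ne_zero hu
    rw [h hz, clearedY]
    simp [h1, h2, h3, Complex.exp_ne_zero]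
  · refine left_ne_zero_of_mul (b := clearedY τ R a b s (-v)) ?_
    rw [clearedY_mul_neg hu hq hv]
    exact pow_ne_zero _ (sub_ne_zero.2 hz)

lemma isSpectralData_sheetProj (hχ : theta1 τ (chi τ α β) ≠ 0) (hR : 0 < R)
    (hq : ¬ IsHalfPeriod τ (torsionPt τ R a b)) {N : Matrix (Fin 2) (Fin 2) ℂ[X]}
    (hN : ∀ i j, (N i j).natDegree ≤ R)
    (hNv : ∀ v, ¬ IsHalfPeriod τ v → evalMat N (wp τ v) = Phi τ α β v *
        Matrix.diagonal ![clearedY τ R a b s v, clearedY τ R a b s (-v)] * (Phi τ α β v)⁻¹)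
    {r : ℝ} (hr : 0 < r) {ν : ℂ → ℂ} (hν : DifferentiableOn ℂ ν (ball (zStar τ R a b) r))
    (hνc : ν (zStar τ R a b) = torsionPt τ R a b)
    (h : ∀ z ∈ ball (zStar τ R a b) r, wp τ (ν z) = z ∧ ¬ IsHalfPeriod τ (ν z)) :
    IsSpectralData (zStar τ R a b) r R N (fun w => sheetProj τ α β (ν w))
      (fun w => clearedY τ R a b s (ν w)) := by
  have hlat (w) (hw : w ∈ ball (zStar τ R a b) r) : ν w ∉ (periods τ).lattice :=
    notMem_of_not_isHalfPeriod (h w hw).2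
  have hdiff (w) (hw : w ∈ ball (zStar τ R a b) r) : DifferentiableAt ℂ ν w :=
    hν.differentiableAt (isOpen_ball.mem_nhds hw)
  have hy0 (w) (hw : w ∈ ball (zStar τ R a b) r) : clearedY τ R a b s (ν w) ≠ 0 := by
    refine clearedY_ne_zero hχ hq (hlat w hw) fun hz => ?_
    rw [(h w hw).1] at hz
    rw [hz, hνc]
  exact
    { natDegree_le := hN
      det_eq := by
        -- The spectral formula computes the determinant on a ball only, but two polynomials
        -- agreeing on an infinite set coincide.
        refine Polynomial.eq_of_infinite_eval_eq _ _
          ((infinite_of_mem_nhds _ (ball_mem_nhds (zStar τ R a b) hr)).mono fun w hw => ?_)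
        have h1 := hNv _ (h w hw).2
        have h2 := clearedY_mul_neg (s := s) hχ hq (hlat w hw)
        rw [(h w hw).1] at h1 h2
        have h3 := det_Phi_ne_zero hχ (h w hw).2
        change N.det.eval w = _
        rw [← evalMat_det, h1, Matrix.det_mul, Matrix.det_mul, Matrix.det_diagonal,
          Fin.prod_univ_two, Matrix.det_nonsing_inv, Ring.inverse_eq_inv', mul_right_comm,
          mul_inv_cancel₀ h3, one_mul]
        simpa using h2
      differentiableOn := fun i j w hw =>
        ((differentiableAt_sheetProj hχ (h w hw).2 i j).comp w
          (hdiff w hw)).differentiableWithinAt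
      differentiableOn_eigenvalue := fun w hw =>
        (((isEllipticLE_clearedY hχ hR).differentiableAt _ (hlat w hw)).comp w
          (hdiff w hw)).differentiableWithinAt
      eigenvalue_ne_zero := hy0
      mul_self := fun w hw => sheetProj_mul_self hχ (h w hw).2
      trace_eq := fun w hw => trace_sheetProj hχ (h w hw).2
      eq_add := fun w hw => by
        have h1 := hNv _ (h w hw).2
        have h2 := clearedY_mul_neg (s := s) hχ hq (hlat w hw)
        rw [(h w hw).1] at h1 h2
        rw [h1, Phi_mul_diagonal_mul_inv hχ (h w hw).2, ← h2, mul_div_cancel_left₀ _ (hy0 w hw)] }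

lemma isSqrtWeight_of_polynomial (hχ : theta1 τ (chi τ α β) ≠ 0)
    (hq : ¬ IsHalfPeriod τ (torsionPt τ R a b)) {N : Matrix (Fin 2) (Fin 2) ℂ[X]}
    (hNv : ∀ v, ¬ IsHalfPeriod τ v → evalMat N (wp τ v) = Phi τ α β v *
        Matrix.diagonal ![clearedY τ R a b s v, clearedY τ R a b s (-v)] * (Phi τ α β v)⁻¹) :
    IsSqrtWeight τ α β R a b s (fun z => ((z - zStar τ R a b) ^ R)⁻¹ • evalMat N z) := by
  intro v hv hvz
  have hv' := notMem_of_not_isHalfPeriod hv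
  have hneg : wp τ (-v) = wp τ v := (periods τ).weierstrassP_neg v
  have hD : (wp τ v - zStar τ R a b) ^ R ≠ 0 := pow_ne_zero _ (sub_ne_zero.2 hvz)
  have h1 := clearedY_eq (s := s) hχ hq hv' hvz
  have h2 := clearedY_eq (s := s) hχ hq (notMem_neg hv') (by rwa [hneg])
  rw [hneg] at h2
  simp only [hNv v hv, Phi_mul_diagonal_mul_inv hχ hv, h1, h2, mul_smul, ← smul_add]
  rw [smul_smul, inv_mul_cancel₀ hD, one_smul]

end sheetProj

end EllipticMOP

theorem mainTheorem10 (τ : UpperHalfPlane) (α β : ℝ) (hχ : theta1 τ (chi τ α β) ≠ 0)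
    (R : ℕ) (hR : 0 < R) (a b : ℤ) (hq : ¬ IsHalfPeriod τ (torsionPt τ R a b)) (s : ℤˣ) :
    ∃ (sqrtW : ℂ → Matrix (Fin 2) (Fin 2) ℂ) (r : ℝ) (ν : ℂ → ℂ)
      (P : Matrix (Fin 2) (Fin 2) (Polynomial ℂ)),
      IsSqrtWeight τ α β R a b s sqrtW ∧
      0 < r ∧ IsMainSheet τ R a b r ν ∧
      (∀ i j, (P i j).natDegree ≤ R - 1) ∧
      ∀ ε : ℝ, 0 < ε → ε < r →
        (∀ v : ℂ, ¬ IsHalfPeriod τ v → ε < ‖wp τ v - zStar τ R a b‖ →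
          evalMat P (wp τ v) = mopFormula τ α β R a b ν sqrtW ε (wp τ v)) ∧
        ∀ ℓ : ℕ, ℓ + 2 ≤ R →
          (∀ i j, CircleIntegrable
            (fun z => (z ^ ℓ • (evalMat P z * sqrtW z ^ 2)) i j) (zStar τ R a b) ε) ∧
          matCircleIntegral (fun z => z ^ ℓ • (evalMat P z * sqrtW z ^ 2))
            (zStar τ R a b) ε = 0 := by
  obtain ⟨N, hN, hNv⟩ := exists_polynomial_weight (a := a) (b := b) (s := s) hχ hR
  obtain ⟨r, ν, hr, hν, hνc, hνz⟩ := exists_local_inverse_wp hχ hq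
  obtain ⟨P, hP, h⟩ :=
    (isSpectralData_sheetProj hχ hR hq hN hNv hr hν hνc hνz).exists_orthogonal hr hR
  exact ⟨fun z => ((z - zStar τ R a b) ^ R)⁻¹ • evalMat N z, r, ν, P,
    isSqrtWeight_of_polynomial hχ hq hNv, hr, ⟨hν, hνc, fun z hz => (hνz z hz).1⟩, hP,
    fun ε hε hεr => ⟨fun v _ hz => (h ε hε hεr).1 _ hz, (h ε hε hεr).2⟩⟩
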